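/- There is a deterministic combinatorial $\frac34$-approximation algorithm for Max-Cut in connected graphs of maximum degree at most four that runs in time $O(n)$. Precisely: there are a single program for a unit-cost random access machine and a constant $C$ such that, for every connected finite simple graph $G$ with vertex set $\{0,\dots,n-1\}$ and maximum degree at most $4$, given by its adjacency lists (each in an arbitrary order), the program halts after at most $C\,n$ steps and outputs a set $A\subseteq V(G)$ with $$|E_G(A,V(G)\setminus A)|\;\ge\;\tfrac34\,mc(G),$$ where $E_G(A,V(G)\setminus A)$ is the set of edges with exactly one end in $A$ and $mc(G)=\max_{B\subseteq V(G)}|E_G(B,V(G)\setminus B)|$. The algorithm is combinatorial in that it uses no numerical operations: apart from reading and writing memory cells addressed by registers, the machine can only load constants and copy, increment, decrement and compare nonnegative integers (all memory other than the input being zero at the start), each such operation counting as one step. -/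

import Mathlib

/-! ### Cuts -/

/-- The set of edges of `G` with one end in `A` and the other end outside `A`: the edges of the
cut given by the partition `A`, `V \ A` of the vertex set. -/
def cutEdges {V : Type*} (G : SimpleGraph V) (A : Finset V) : Set (Sym2 V) :=
  {e | ∃ u v : V, u ∈ A ∧ v ∉ A ∧ G.Adj u v ∧ e = s(u, v)}

/-- The size of the cut given by the partition `A`, `V \ A`. -/
noncomputable def cutSize {V : Type*} (G : SimpleGraph V) (A : Finset V) : ℕ :=
  (cutEdges G A).ncard

/-- The size of a maximum cut of a finite graph. -/
noncomputable def maxCut {V : Type*} [Fintype V] (G : SimpleGraph V) : ℕ :=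
  (Finset.univ : Finset (Finset V)).sup (cutSize G)

/-! ### The machine model

A deterministic random access machine with unit costs. It has registers and arrays holding natural
numbers. Its only operations on numbers are copying, incrementing, decrementing and comparing; its
memory can be addressed indirectly through registers. A number held by the machine can grow by at
most one per step, so that a linear number of steps never uses more than logarithmically many bits
per memory cell: unit costs hide no arithmetic on large numbers. -/

namespace RAM

/-- A memory state: the contents of the registers, and of the arrays (array name, then index). -/
@[ext]
structure State where
  reg : ℕ → ℕ
  arr : ℕ → ℕ → ℕ

/-- Elementary instructions; `x`, `y`, `i` are names of registers and `a` is the name of an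
array. -/
inductive Instr where
  /-- `x := c` for a constant `c` -/
  | const (x c : ℕ)
  /-- `x := y` -/
  | copy (x y : ℕ)
  /-- `x := x + 1` -/
  | inc (x : ℕ)
  /-- `x := x - 1`, where `0 - 1` is `0` -/
  | dec (x : ℕ)
  /-- `x := a[i]` -/
  | load (x a i : ℕ)
  /-- `a[i] := x` -/
  | store (a i x : ℕ)

/-- The effect of an elementary instruction. -/
def Instr.eval : Instr → State → State
  | .const x c, s => { s with reg := Function.update s.reg x c }
  | .copy x y, s => { s with reg := Function.update s.reg x (s.reg y) }
  | .inc x, s => { s with reg := Function.update s.reg x (s.reg x + 1) }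
  | .dec x, s => { s with reg := Function.update s.reg x (s.reg x - 1) }
  | .load x a i, s => { s with reg := Function.update s.reg x (s.arr a (s.reg i)) }
  | .store a i x, s =>
      { s with arr := Function.update s.arr a (Function.update (s.arr a) (s.reg i) (s.reg x)) }

/-- Comparisons of two registers. -/
inductive Test where
  | eq (x y : ℕ)
  | ne (x y : ℕ)
  | lt (x y : ℕ)
  | le (x y : ℕ)

/-- The comparison succeeds in a given state. -/
def Test.Holds : Test → State → Prop
  | .eq x y, s => s.reg x = s.reg y
  | .ne x y, s => s.reg x ≠ s.reg y
  | .lt x y, s => s.reg x < s.reg y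
  | .le x y, s => s.reg x ≤ s.reg y

/-- Programs: finite texts, built from instructions by sequencing, branching and looping. -/
inductive Prog where
  | skip
  | instr (I : Instr)
  | seq (p q : Prog)
  | ite (b : Test) (p q : Prog)
  | loop (b : Test) (p : Prog)

/-- `Exec p s s' t`: the program `p`, started in the state `s`, halts in the state `s'` after
exactly `t` steps. Each execution of an instruction and each evaluation of a test is one step. -/
inductive Exec : Prog → State → State → ℕ → Prop
  | skip (s : State) : Exec .skip s s 1
  | instr (I : Instr) (s : State) : Exec (.instr I) s (I.eval s) 1
  | seq {p q : Prog} {s s' s'' : State} {t t' : ℕ} :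
      Exec p s s' t → Exec q s' s'' t' → Exec (.seq p q) s s'' (t + t')
  | ite_true {b : Test} {p q : Prog} {s s' : State} {t : ℕ} :
      b.Holds s → Exec p s s' t → Exec (.ite b p q) s s' (t + 1)
  | ite_false {b : Test} {p q : Prog} {s s' : State} {t : ℕ} :
      ¬ b.Holds s → Exec q s s' t → Exec (.ite b p q) s s' (t + 1)
  | loop_true {b : Test} {p : Prog} {s s' s'' : State} {t t' : ℕ} :
      b.Holds s → Exec p s s' t → Exec (.loop b p) s' s'' t' → Exec (.loop b p) s s'' (t + t' + 1)
  | loop_false {b : Test} {p : Prog} {s : State} :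
      ¬ b.Holds s → Exec (.loop b p) s s 1

/-- The machine is deterministic: final state and number of steps are determined by the program
and the initial state. -/
theorem Exec.unique {p : Prog} {s s₁ s₂ : State} {t₁ t₂ : ℕ}
    (h₁ : Exec p s s₁ t₁) (h₂ : Exec p s s₂ t₂) : s₁ = s₂ ∧ t₁ = t₂ := by
  induction h₁ generalizing s₂ t₂ with
  | skip s => cases h₂; exact ⟨rfl, rfl⟩
  | instr I s => cases h₂; exact ⟨rfl, rfl⟩
  | seq _ _ ih₁ ih₂ =>
    cases h₂ with
    | seq k₁ k₂ =>
      obtain ⟨rfl, rfl⟩ := ih₁ k₁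
      obtain ⟨rfl, rfl⟩ := ih₂ k₂
      exact ⟨rfl, rfl⟩
  | ite_true hb _ ih =>
    cases h₂ with
    | ite_true _ k => obtain ⟨rfl, rfl⟩ := ih k; exact ⟨rfl, rfl⟩
    | ite_false hb' _ => exact absurd hb hb'
  | ite_false hb _ ih =>
    cases h₂ with
    | ite_true hb' _ => exact absurd hb' hb
    | ite_false _ k => obtain ⟨rfl, rfl⟩ := ih k; exact ⟨rfl, rfl⟩
  | loop_true hb _ _ ih₁ ih₂ =>
    cases h₂ with
    | loop_true _ k₁ k₂ =>
      obtain ⟨rfl, rfl⟩ := ih₁ k₁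
      obtain ⟨rfl, rfl⟩ := ih₂ k₂
      exact ⟨rfl, rfl⟩
    | loop_false hb' => exact absurd hb hb'
  | loop_false hb =>
    cases h₂ with
    | loop_true hb' _ _ => exact absurd hb' hb
    | loop_false _ => exact ⟨rfl, rfl⟩

end RAM

/-! ### Input and output -/

/-- `L` is a representation of `G` by adjacency lists: `L v` lists the neighbours of `v`, each of
them once, in an arbitrary order. -/
def IsAdjacencyLists {n : ℕ} (G : SimpleGraph (Fin n)) (L : Fin n → List (Fin n)) : Prop :=
  ∀ v : Fin n, (L v).Nodup ∧ ∀ u : Fin n, u ∈ L v ↔ G.Adj v u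

/-- The position in the concatenation of all adjacency lists at which the list of `v` begins. -/
def listStart {n : ℕ} (L : Fin n → List (Fin n)) (v : ℕ) : ℕ :=
  ∑ u : Fin n, if (u : ℕ) < v then (L u).length else 0

/-- The concatenation of all adjacency lists, as a list of numbers. -/
def concatLists {n : ℕ} (L : Fin n → List (Fin n)) : List ℕ :=
  (List.ofFn fun v => (L v).map fun u => (u : ℕ)).flatten

/-- The initial state for a graph with vertices `0, …, n - 1` given by adjacency lists `L`:
register `0` holds `n`; array `0` holds at index `v ≤ n` the start of the list of `v`
(so the list of `v` occupies the positions from that start up to, but excluding, the next start);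
array `1` holds the concatenated lists. Everything else is zero. -/
def inputState {n : ℕ} (L : Fin n → List (Fin n)) : RAM.State where
  reg x := if x = 0 then n else 0
  arr a i :=
    if a = 0 then (if i ≤ n then listStart L i else 0)
    else if a = 1 then (concatLists L).getD i 0
    else 0

/-- The side of the cut that a final state describes: the vertices `v` for which array `2` holds
`1` at index `v`. -/
def outputSide (n : ℕ) (s : RAM.State) : Finset (Fin n) :=
  Finset.univ.filter fun v => s.arr 2 v = 1

/-! Depth first search gives a spanning tree in which every edge of the graph joins a vertex to one
of its ancestors. The parity of the depth colours the tree properly, so an edge closes an odd cycle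
with the tree exactly if its ends have equal parity. Bottom-up, the tree edge above `y` is cut when
such an edge leads from the piece hanging at `y` to the parent of `y`; cutting is postponed to this
last moment. The tree falls into `N` pieces. Each is properly coloured by parity, and each piece
without the root forms, with the parent of its top vertex, the carrier of an odd closed walk.
Charging an edge to the piece of its end with the larger number makes these walks edge-disjoint, so
every cut misses at least `N - 1` edges (`card_pieces_le`).

The pieces are then turned, again bottom-up, so that at least half of the edges between pieces are
cut (`IsBalancing.card_le`). All edges inside pieces are cut, and there are at least `n - N` of
them. With `m ≤ 2n` edges the cut has at least `(m + n - N)/2 ≥ 3m/4 - N/2` edges, against at most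
`m - (N - 1)` for any cut. This gives the ratio for `N ≥ 3`; for `N = 1` everything is cut. If `N =
2`, it can only fail by a fraction of an edge, when some cut misses exactly one edge, the graph is
`4`-regular and the pieces are induced trees. Gaining one edge by moving a single vertex repairs
this; if no move gains, `uncut_le_one_of_locally_optimal` shows that the cut itself misses at most
one edge.

For the running time, each phase is a loop of at most `2n` rounds whose body has no loops, since the
at most four neighbours are scanned by unrolled code. `exec_loop` turns an invariant with a
decreasing bound into correctness and time. The invariants pair a combinatorial stage
(`IsPartialSearch`, `IsCutMarking`, `IsBalancing`) with a predicate saying that the arrays store it.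
-/

/-! ### Counting cut and uncut edges -/

section Combinatorics

variable {V : Type*} [Fintype V] (G : SimpleGraph V) [DecidableRel G.Adj]

/-- The edges of `G`, each oriented towards its end with the larger number. -/
def upDarts (d : V → ℕ) : Finset (V × V) :=
  Finset.univ.filter fun p => G.Adj p.1 p.2 ∧ d p.1 < d p.2

/-- The number of edges whose ends get different colours. -/
def crossing (d : V → ℕ) (s : V → Bool) : ℕ :=
  ((upDarts G d).filter fun p => s p.1 ≠ s p.2).card

/-- The number of edges whose ends get the same colour. -/
def uncut (d : V → ℕ) (s : V → Bool) : ℕ :=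
  ((upDarts G d).filter fun p => s p.1 = s p.2).card

def crossDeg (s : V → Bool) (v : V) : ℕ :=
  (Finset.univ.filter fun w => G.Adj v w ∧ s v ≠ s w).card

def innerDeg (s : V → Bool) (v : V) : ℕ :=
  (Finset.univ.filter fun w => G.Adj v w ∧ s v = s w).card

variable {G}

theorem mem_upDarts {d : V → ℕ} {p : V × V} :
    p ∈ upDarts G d ↔ G.Adj p.1 p.2 ∧ d p.1 < d p.2 := by
  simp [upDarts]

theorem crossing_add_uncut (d : V → ℕ) (s : V → Bool) :
    crossing G d s + uncut G d s = (upDarts G d).card := by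
  have := Finset.card_filter_add_card_filter_not (s := upDarts G d) (fun p => s p.1 ≠ s p.2)
  simpa [crossing, uncut] using this

theorem crossDeg_add_innerDeg (s : V → Bool) (v : V) :
    crossDeg G s v + innerDeg G s v = G.degree v := by
  have := Finset.card_filter_add_card_filter_not (s := G.neighborFinset v) (fun w => s v ≠ s w)
  rw [G.card_neighborFinset_eq_degree] at this
  rw [← this, crossDeg, innerDeg]
  congr 2 <;> ext w <;> simp

theorem two_mul_card_upDarts {d : V → ℕ} (hd : Function.Injective d) :
    2 * (upDarts G d).card = ∑ v, G.degree v := by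
  have h1 : ∑ v, G.degree v = (Finset.univ.filter fun p : V × V => G.Adj p.1 p.2).card := by
    simp_rw [← G.card_neighborFinset_eq_degree]
    rw [← Finset.card_sigma]
    refine Finset.card_bij (fun p _ => (p.1, p.2)) ?_ ?_ ?_
    · rintro ⟨a, b⟩; simp
    · rintro ⟨a, b⟩ _ ⟨a', b'⟩ _ h; simpa using h
    · rintro ⟨a, b⟩ h; exact ⟨⟨a, b⟩, by simpa using h, rfl⟩
  have h2 := Finset.card_filter_add_card_filter_not
    (s := Finset.univ.filter fun p : V × V => G.Adj p.1 p.2) (fun p => d p.1 < d p.2)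
  have h3 : ((Finset.univ.filter fun p : V × V => G.Adj p.1 p.2).filter
      fun p => ¬ d p.1 < d p.2).card = (upDarts G d).card := by
    refine Finset.card_bij (fun p _ => (p.2, p.1)) ?_ ?_ ?_
    · rintro ⟨a, b⟩ h
      simp only [Finset.mem_filter, Finset.mem_univ, true_and, not_lt, mem_upDarts] at h ⊢
      exact ⟨h.1.symm, lt_of_le_of_ne h.2 fun e => h.1.ne (hd e).symm⟩
    · rintro ⟨a, b⟩ _ ⟨a', b'⟩ _ h; simp at h ⊢; tauto
    · rintro ⟨a, b⟩ h
      rw [mem_upDarts] at h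
      exact ⟨(b, a), by simpa using ⟨h.1.symm, h.2.le⟩, rfl⟩
  have h4 : (Finset.univ.filter fun p : V × V => G.Adj p.1 p.2).filter
      (fun p => d p.1 < d p.2) = upDarts G d := by
    ext p; simp [mem_upDarts]
  rw [h3, h4] at h2
  omega

theorem cutSize_eq_crossing [DecidableEq V] {d : V → ℕ} (hd : Function.Injective d)
    (A : Finset V) :
    cutSize G A = crossing G d (fun v => decide (v ∈ A)) := by
  classical
  rw [cutSize, crossing, ← Set.ncard_coe_finset]
  symm
  refine Set.ncard_congr (fun p _ => s(p.1, p.2)) ?_ ?_ ?_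
  · rintro ⟨a, b⟩ h
    simp only [Finset.coe_filter, Set.mem_ofPred_eq, mem_upDarts] at h
    obtain ⟨⟨h1, -⟩, h2⟩ := h
    by_cases ha : a ∈ A
    · exact ⟨a, b, ha, by simpa [ha] using h2, h1, rfl⟩
    · exact ⟨b, a, by simpa [ha] using h2, ha, h1.symm, Sym2.eq_swap⟩
  · rintro ⟨a, b⟩ ⟨a', b'⟩ h h' e
    simp only [Finset.coe_filter, Set.mem_ofPred_eq, mem_upDarts] at h h'
    rw [Sym2.eq_iff] at e
    rcases e with ⟨e1, e2⟩ | ⟨e1, e2⟩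
    · simp_all
    · simp only at e1 e2
      subst e1 e2
      exact absurd h.1.2 (by simpa using h'.1.2.le)
  · rintro e ⟨u, v, hu, hv, huv, rfl⟩
    rcases lt_or_gt_of_ne (fun e => huv.ne (hd e) : d u ≠ d v) with h | h
    · exact ⟨(u, v), by simp [mem_upDarts, huv, h, hu, hv], rfl⟩
    · exact ⟨(v, u), by simp [mem_upDarts, huv.symm, h, hu, hv], Sym2.eq_swap⟩

/-- Changing the colour of one vertex exchanges the roles of cut and uncut edges at it. -/
theorem crossing_update [DecidableEq V] {d : V → ℕ} (hd : Function.Injective d) (s : V → Bool)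
    (v : V) :
    crossing G d (Function.update s v (!s v)) + crossDeg G s v =
      crossing G d s + innerDeg G s v := by
  -- Only edges at `v` change their status. The cut edges at `v` correspond to its neighbours of the
  -- other colour, whichever end carries the larger number.
  have split : ∀ f : V → Bool, crossing G d f =
      ((upDarts G d).filter fun p => f p.1 ≠ f p.2 ∧ p.1 ≠ v ∧ p.2 ≠ v).card +
        crossDeg G f v := by
    intro f
    have h := Finset.card_filter_add_card_filter_not
      (s := (upDarts G d).filter fun p => f p.1 ≠ f p.2) (fun p => p.1 ≠ v ∧ p.2 ≠ v)
    rw [crossing, ← h, Finset.filter_filter]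
    congr 1
    refine Finset.card_bij (fun p _ => if p.1 = v then p.2 else p.1) ?_ ?_ ?_
    · rintro ⟨a, b⟩ h
      simp only [Finset.mem_filter, mem_upDarts, Finset.mem_univ, true_and] at h ⊢
      obtain ⟨⟨⟨h1, h2⟩, h3⟩, h4⟩ := h
      split_ifs with e
      · subst e; exact ⟨h1, h3⟩
      · have : b = v := by tauto
        subst this; exact ⟨h1.symm, h3.symm⟩
    · rintro ⟨a, b⟩ h ⟨a', b'⟩ h' e
      simp only [Finset.mem_filter, mem_upDarts] at h h' e
      obtain ⟨⟨⟨h1, h2⟩, h3⟩, h4⟩ := h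
      obtain ⟨⟨⟨h1', h2'⟩, h3'⟩, h4'⟩ := h'
      have g1 : a = v ∨ b = v := by tauto
      have g2 : a' = v ∨ b' = v := by tauto
      have n1 : a ≠ b := h1.ne
      have n2 : a' ≠ b' := h1'.ne
      split_ifs at e with e1 e2 e2
      · simp_all
      · have : b' = v := by tauto
        subst e1 this e
        omega
      · have : b = v := by tauto
        subst e2 this e
        omega
      · have : b = v := by tauto
        have : b' = v := by tauto
        simp_all
    · intro w hw
      simp only [Finset.mem_filter, Finset.mem_univ, true_and] at hw
      rcases lt_or_gt_of_ne (fun e => hw.1.ne (hd e) : d v ≠ d w) with h | h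
      · exact ⟨(v, w), by simp [mem_upDarts, hw, h], by simp⟩
      · exact ⟨(w, v), by simp [mem_upDarts, hw.1.symm, h, Ne.symm hw.2], by simp [hw.1.ne']⟩
  have e1 : ((upDarts G d).filter fun p => Function.update s v (!s v) p.1 ≠
        Function.update s v (!s v) p.2 ∧ p.1 ≠ v ∧ p.2 ≠ v) =
      (upDarts G d).filter fun p => s p.1 ≠ s p.2 ∧ p.1 ≠ v ∧ p.2 ≠ v := by
    refine Finset.filter_congr fun p _ => ?_
    by_cases h1 : p.1 = v <;> by_cases h2 : p.2 = v <;> simp [h1, h2]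
  have e2 : crossDeg G (Function.update s v (!s v)) v = innerDeg G s v := by
    rw [crossDeg, innerDeg]
    congr 1
    refine Finset.filter_congr fun w _ => ?_
    refine and_congr_right fun h => ?_
    rw [Function.update_self, Function.update_of_ne h.ne']
    cases s v <;> cases s w <;> simp
  rw [split, split s, e1, e2]
  omega

end Combinatorics

/-! ### Decompositions into properly coloured pieces -/

section Approximation

variable {V : Type*} (G : SimpleGraph V)

/-- A partition of the vertices into pieces, each spanned by a part of the tree with root `r` and
parents `pa`, and properly coloured by `col`. The piece of `v` is named by its vertex `lab v` with
the smallest number. Each piece avoiding `r` lies on an odd closed walk through the parent of its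
name. -/
structure Decomposition (r : V) (d : V → ℕ) (pa lab : V → V) (col : V → Bool) : Prop where
  inj : Function.Injective d
  adj : ∀ v, v ≠ r → G.Adj (pa v) v
  lt : ∀ v, v ≠ r → d (pa v) < d v
  col_ne : ∀ v, v ≠ r → col (pa v) ≠ col v
  lab_root : lab r = r
  lab_eq : ∀ v, v ≠ r → lab v = v ∨ lab v = lab (pa v)
  proper : ∀ u v, G.Adj u v → lab u = lab v → col u ≠ col v
  odd : ∀ v, v ≠ r → lab v = v → ∃ x, lab x = v ∧ G.Adj (pa v) x ∧ col x = col (pa v)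

namespace Decomposition

variable {G} {r : V} {d : V → ℕ} {pa lab : V → V} {col : V → Bool}

theorem rec_tree (D : Decomposition G r d pa lab col) {P : V → Prop} (hr : P r)
    (hs : ∀ v, v ≠ r → P (pa v) → P v) (v : V) : P v := by
  induction h : d v using Nat.strong_induction_on generalizing v with
  | _ k ih =>
    by_cases hv : v = r
    · exact hv ▸ hr
    · exact hs v hv (ih _ (h ▸ D.lt v hv) _ rfl)

theorem d_lab_le (D : Decomposition G r d pa lab col) (v : V) : d (lab v) ≤ d v := by
  induction v using D.rec_tree with
  | hr => rw [D.lab_root]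
  | hs v hv ih =>
    rcases D.lab_eq v hv with h | h
    · rw [h]
    · rw [h]; exact ih.trans (D.lt v hv).le

theorem lab_lab (D : Decomposition G r d pa lab col) (v : V) : lab (lab v) = lab v := by
  induction v using D.rec_tree with
  | hr => rw [D.lab_root, D.lab_root]
  | hs v hv ih =>
    rcases D.lab_eq v hv with h | h
    · rw [h, h]
    · rw [h, ih]

theorem ne_root (D : Decomposition G r d pa lab col) {v : V} (h : lab v ≠ v) : v ≠ r := by
  rintro rfl; exact h D.lab_root

theorem lab_pa (D : Decomposition G r d pa lab col) {v : V} (h : lab v ≠ v) : lab (pa v) = lab v :=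
  ((D.lab_eq v (D.ne_root h)).resolve_left h).symm

/-- A function that is constant along the tree edges of a piece is constant on the piece. -/
theorem const_on_piece (D : Decomposition G r d pa lab col) {α : Type*} {g : V → α} {l : V}
    (h : ∀ v, lab v = l → v ≠ l → g (pa v) = g v) (v : V) (hv : lab v = l) : g v = g l := by
  induction v using D.rec_tree with
  | hr => rw [← hv, D.lab_root]
  | hs v hr ih =>
    by_cases e : v = l
    · rw [e]
    · rw [← h v hv e]
      exact ih ((D.lab_pa (by rw [hv]; exact Ne.symm e)).trans hv)

variable [Fintype V] [DecidableEq V]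

theorem tree_dart [DecidableRel G.Adj] (D : Decomposition G r d pa lab col) {v : V}
    (h : lab v ≠ v) :
    (pa v, v) ∈ (upDarts G d).filter fun p => lab p.1 = lab p.2 := by
  rw [Finset.mem_filter, mem_upDarts]
  exact ⟨⟨D.adj v (D.ne_root h), D.lt v (D.ne_root h)⟩, D.lab_pa h⟩

theorem tree_darts_subset [DecidableRel G.Adj] (D : Decomposition G r d pa lab col) :
    ((Finset.univ.filter fun v => lab v ≠ v).image fun v => (pa v, v)) ⊆
      (upDarts G d).filter fun p => lab p.1 = lab p.2 := by
  intro p hp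
  obtain ⟨v, hv, rfl⟩ := Finset.mem_image.1 hp
  exact D.tree_dart (Finset.mem_filter.1 hv).2

/-- A tree edge is determined by its lower end, so each vertex that does not name a piece
contributes its own edge. -/
theorem card_tree_darts :
    ((Finset.univ.filter fun v => lab v ≠ v).image fun v => (pa v, v)).card +
      (Finset.univ.filter fun v => lab v = v).card = Fintype.card V := by
  rw [Finset.card_image_of_injective _ fun a b h => (Prod.ext_iff.1 h).2, add_comm]
  exact Finset.card_filter_add_card_filter_not (s := Finset.univ) (fun v => lab v = v)

/-- A piece avoiding the root forces an uncut edge in every cut. -/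
theorem exists_uncut [DecidableRel G.Adj] (D : Decomposition G r d pa lab col) (t : V → Bool)
    {c : V} (hc : lab c = c) (hr : c ≠ r) :
    ∃ p ∈ upDarts G d, t p.1 = t p.2 ∧ lab p.2 = c := by
  by_contra! H
  -- If every edge charged to the piece is cut by `t`, then `t` and `col` differ by a constant along
  -- the tree edges of the piece, and also across the edge from `c` to its parent.
  have key : ∀ v, v ≠ r → lab v = c → (t (pa v) ^^ col (pa v)) = (t v ^^ col v) := by
    intro v hv hl
    have h1 := D.col_ne v hv
    have h2 := mt (H (pa v, v) (mem_upDarts.2 ⟨D.adj v hv, D.lt v hv⟩)) (by simpa using hl)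
    revert h1 h2
    cases t (pa v) <;> cases col (pa v) <;> cases t v <;> cases col v <;> simp
  obtain ⟨x, hx, hadj, hcol⟩ := D.odd c hr hc
  have h1 := D.const_on_piece (g := fun v => t v ^^ col v) (l := c)
    (fun v hv hne => key v (D.ne_root (by rw [hv]; exact Ne.symm hne)) hv) x hx
  have h2 := key c hr hc
  -- The edge closing the odd walk has its larger number at `x`, so it too is charged to the piece
  -- `c`.
  have hlt : d (pa c) < d x := (D.lt c hr).trans_le (hx ▸ D.d_lab_le x)
  have h3 := mt (H (pa c, x) (mem_upDarts.2 ⟨hadj, hlt⟩)) (by simpa using hx)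
  simp only at h1 h3
  rw [← h2, hcol] at h1
  revert h1 h3
  cases t x <;> cases t (pa c) <;> cases col (pa c) <;> simp

/-- The uncut edges supplied by `exists_uncut` for different pieces are different, since the piece
can be read off from the end with the larger number. The root's piece supplies none, whence the `+
1`. -/
theorem card_pieces_le [DecidableRel G.Adj] (D : Decomposition G r d pa lab col) (t : V → Bool) :
    (Finset.univ.filter fun v => lab v = v).card ≤ uncut G d t + 1 := by
  have h1 : ((Finset.univ.filter fun v => lab v = v).erase r).card ≤ uncut G d t := by
    refine (Finset.card_le_card ?_).trans (Finset.card_image_le (f := fun p : V × V => lab p.2))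
    intro c hc
    simp only [Finset.mem_erase, Finset.mem_filter, Finset.mem_univ, true_and] at hc
    obtain ⟨p, hp, h2, h3⟩ := D.exists_uncut t hc.2 hc.1
    exact Finset.mem_image.2 ⟨p, Finset.mem_filter.2 ⟨hp, h2⟩, h3⟩
  have h2 := Finset.card_erase_add_one
    (s := Finset.univ.filter fun v => lab v = v) (a := r) (by simp [D.lab_root])
  omega


end Decomposition

end Approximation

/-! ### The extremal case and the approximation ratio -/

section Approximation

variable {V : Type*} {G : SimpleGraph V}

namespace Decomposition

variable {r : V} {d : V → ℕ} {pa lab : V → V} {col : V → Bool}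
variable [Fintype V] [DecidableEq V] [DecidableRel G.Adj]

/-- In a cut that is optimal with respect to moving single vertices of a `4`-regular graph, no set
of vertices can be both spanned by tree edges and left by at most one edge of the cut. -/
theorem eq_empty_of_locally_optimal (D : Decomposition G r d pa lab col) (s : V → Bool)
    (hdeg : ∀ v, G.degree v = 4) (hopt : ∀ v, innerDeg G s v ≤ crossDeg G s v) (S : Finset V)
    (htree : ∀ x ∈ S, ∀ y ∈ S, G.Adj x y → d x < d y → x = pa y ∧ y ≠ r)
    (hout : (Finset.univ.filter fun p : V × V =>
      p.1 ∈ S ∧ p.2 ∉ S ∧ G.Adj p.1 p.2 ∧ s p.1 ≠ s p.2).card ≤ 1) : S = ∅ := by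
  by_contra hne
  obtain ⟨z, hz, hmin⟩ := S.exists_min_image d (Finset.nonempty_iff_ne_empty.2 hne)
  set C := Finset.univ.filter fun p : V × V => p.1 ∈ S ∧ G.Adj p.1 p.2 ∧ s p.1 ≠ s p.2 with hC
  -- Local optimality and degree four put at least two cut edges at each vertex of `S`.
  have h1 : 2 * S.card ≤ C.card := by
    rw [Finset.card_eq_sum_card_fiberwise (f := Prod.fst) (t := S)
      (fun p hp => by simp [hC] at hp; exact hp.1), mul_comm, ← smul_eq_mul]
    refine Finset.card_nsmul_le_sum _ _ _ fun x hx => ?_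
    have e : (C.filter fun p => p.1 = x).card = crossDeg G s x := by
      symm
      refine Finset.card_bij (fun w _ => (x, w)) ?_ ?_ ?_
      · intro w hw; simp at hw; simp [hC, hx, hw]
      · intro a _ b _ h; simpa using h
      · rintro ⟨a, b⟩ h
        simp only [hC, Finset.mem_filter, Finset.mem_univ, true_and] at h
        obtain ⟨h, rfl⟩ := h
        exact ⟨b, by simpa using h.2, rfl⟩
    rw [e]
    have := crossDeg_add_innerDeg (G := G) s x
    have := hopt x
    have := hdeg x
    omega
  set A := Finset.univ.filter fun p : V × V => p.1 ∈ S ∧ p.2 ∈ S ∧ G.Adj p.1 p.2 ∧ d p.1 < d p.2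
    with hA
  -- Edges inside `S` are tree edges, determined by their lower ends, and the vertex `z` of least
  -- number in `S` is not such a lower end.
  have hA1 : A.card + 1 ≤ S.card := by
    have : A.card ≤ (S.erase z).card := by
      refine Finset.card_le_card_of_injOn Prod.snd ?_ ?_
      · rintro ⟨a, b⟩ h
        simp only [hA, Finset.coe_filter, Finset.mem_univ, true_and, Set.mem_ofPred_eq] at h
        simp only [Finset.coe_erase, Set.mem_sdiff, Finset.mem_coe, Set.mem_singleton_iff]
        refine ⟨h.2.1, ?_⟩
        rintro rfl
        exact absurd (hmin a h.1) (not_le.2 h.2.2.2)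
      · rintro ⟨a, b⟩ h ⟨a', b'⟩ h' e
        simp only [hA, Finset.coe_filter, Finset.mem_univ, true_and, Set.mem_ofPred_eq] at h h' e
        subst e
        rw [(htree _ h.1 _ h.2.1 h.2.2.1 h.2.2.2).1, (htree _ h'.1 _ h'.2.1 h'.2.2.1 h'.2.2.2).1]
    rw [Finset.card_erase_of_mem hz] at this
    have := Finset.card_pos.2 ⟨z, hz⟩
    omega
  -- Edges inside `S` are counted from both ends, so `2|S| ≤ 2(|S| - 1) + 1`, which is absurd.
  have hsub : C ⊆ A ∪ A.image Prod.swap ∪ (Finset.univ.filter fun p : V × V =>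
      p.1 ∈ S ∧ p.2 ∉ S ∧ G.Adj p.1 p.2 ∧ s p.1 ≠ s p.2) := by
    rintro ⟨a, b⟩ h
    simp only [hC, Finset.mem_filter, Finset.mem_univ, true_and] at h
    simp only [hA, Finset.mem_union, Finset.mem_filter, Finset.mem_univ, true_and,
      Finset.mem_image, Prod.exists, Prod.swap_prod_mk, Prod.mk.injEq]
    by_cases hb : b ∈ S
    · left
      rcases lt_or_gt_of_ne (fun e => h.2.1.ne (D.inj e) : d a ≠ d b) with hlt | hlt
      · exact Or.inl ⟨h.1, hb, h.2.1, hlt⟩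
      · exact Or.inr ⟨b, a, ⟨hb, h.1, h.2.1.symm, hlt⟩, rfl, rfl⟩
    · exact Or.inr ⟨h.1, hb, h.2⟩
  have h2 := Finset.card_le_card hsub
  have h3 := Finset.card_union_le (A ∪ A.image Prod.swap) (Finset.univ.filter fun p : V × V =>
      p.1 ∈ S ∧ p.2 ∉ S ∧ G.Adj p.1 p.2 ∧ s p.1 ≠ s p.2)
  have h4 := Finset.card_union_le A (A.image Prod.swap)
  have h5 := Finset.card_image_le (s := A) (f := Prod.swap)
  omega

/-- A single uncut edge of `t` can disturb at most one of the two pieces, so `s` and `t` agree up to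
exchanging sides on the other. The vertices where they disagree span only tree edges, and an edge
cut by `s` that leaves this set is uncut by `t`, so there is at most one. By
`eq_empty_of_locally_optimal` the set is empty, and `s` and `t` give the same cut. -/
theorem uncut_le_one_of_locally_optimal (D : Decomposition G r d pa lab col) (s t : V → Bool)
    (hs : ∀ v w, lab v = lab w → (s v = s w ↔ col v = col w))
    (hdeg : ∀ v, G.degree v = 4) (hopt : ∀ v, innerDeg G s v ≤ crossDeg G s v)
    (hpieces : (Finset.univ.filter fun v => lab v = v).card = 2)
    (htree : ∀ x y, G.Adj x y → d x < d y → lab x = lab y → x = pa y ∧ y ≠ r)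
    (ht : uncut G d t ≤ 1) : uncut G d s ≤ 1 := by
  have huniq : ∀ x y x' y', G.Adj x y → d x < d y → t x = t y → G.Adj x' y' → d x' < d y' →
      t x' = t y' → x = x' ∧ y = y' := by
    intro x y x' y' h1 h2 h3 h4 h5 h6
    have := Finset.card_le_one.1 ht (x, y) (Finset.mem_filter.2 ⟨mem_upDarts.2 ⟨h1, h2⟩, h3⟩)
      (x', y') (Finset.mem_filter.2 ⟨mem_upDarts.2 ⟨h4, h5⟩, h6⟩)
    simpa using this
  -- If `s` and `t` do not differ by a constant on a piece, then `t` fails to cut one of its tree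
  -- edges.
  have hnc : ∀ l, ¬ (∀ v, lab v = l → (s v ^^ t v) = (s l ^^ t l)) →
      ∃ v, lab v = l ∧ v ≠ r ∧ t (pa v) = t v := by
    intro l h
    by_contra! H
    refine h fun v hv => D.const_on_piece (g := fun v => s v ^^ t v) (fun w hw hwl => ?_) v hv
    have hlw : lab w ≠ w := by rw [hw]; exact Ne.symm hwl
    have h1 := H w hw (D.ne_root hlw)
    have h2 := mt (hs (pa w) w (D.lab_pa hlw)).1 (D.col_ne w (D.ne_root hlw))
    revert h1 h2
    cases t (pa w) <;> cases t w <;> cases s (pa w) <;> cases s w <;> simp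
  obtain ⟨b, hb⟩ : ∃ b, (Finset.univ.filter fun v => lab v = v).erase r = {b} := by
    rw [← Finset.card_eq_one, Finset.card_erase_of_mem (by simp [D.lab_root]), hpieces]
  have hbr : b ≠ r ∧ lab b = b := by
    have : b ∈ (Finset.univ.filter fun v => lab v = v).erase r := by simp [hb]
    simpa using this
  have hlab : ∀ v, lab v = r ∨ lab v = b := by
    intro v
    by_contra! H
    have : lab v ∈ (Finset.univ.filter fun v => lab v = v).erase r := by
      simp [D.lab_lab, H.1]
    rw [hb] at this
    exact H.2 (by simpa using this)
  -- Were both pieces disturbed, their uncut tree edges would be the same edge, with its lower end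
  -- in both pieces.
  have hij : ∃ i j, (∀ v, lab v = i ∨ lab v = j) ∧
      ∀ v, lab v = i → (s v ^^ t v) = (s i ^^ t i) := by
    by_cases h1 : ∀ v, lab v = r → (s v ^^ t v) = (s r ^^ t r)
    · exact ⟨r, b, hlab, h1⟩
    by_cases h2 : ∀ v, lab v = b → (s v ^^ t v) = (s b ^^ t b)
    · exact ⟨b, r, fun v => (hlab v).symm, h2⟩
    obtain ⟨v, hv1, hv2, hv3⟩ := hnc r h1
    obtain ⟨w, hw1, hw2, hw3⟩ := hnc b h2
    have := (huniq _ _ _ _ (D.adj v hv2) (D.lt v hv2) hv3 (D.adj w hw2) (D.lt w hw2) hw3).2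
    rw [this, hw1] at hv1
    exact absurd hv1 hbr.1
  obtain ⟨i, j, hl, hi⟩ := hij
  have hS := D.eq_empty_of_locally_optimal s hdeg hopt
    (Finset.univ.filter fun v => (s v ^^ t v) ≠ (s i ^^ t i)) ?_ ?_
  · refine le_trans (le_of_eq ?_) ht
    have key : ∀ v, (s v ^^ t v) = (s i ^^ t i) := by
      intro v
      by_contra h
      have : v ∈ (∅ : Finset V) := hS ▸ Finset.mem_filter.2 ⟨Finset.mem_univ _, h⟩
      simp at this
    rw [uncut, uncut]
    congr 1
    refine Finset.filter_congr fun p _ => ?_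
    have h1 := key p.1
    rw [← key p.2] at h1
    revert h1
    cases s p.1 <;> cases t p.1 <;> cases s p.2 <;> cases t p.2 <;> simp
  · intro x hx y hy hxy hd
    have hx' := (hl x).resolve_left fun h => (Finset.mem_filter.1 hx).2 (hi x h)
    have hy' := (hl y).resolve_left fun h => (Finset.mem_filter.1 hy).2 (hi y h)
    exact htree x y hxy hd (hx'.trans hy'.symm)
  · rw [Finset.card_le_one]
    have hteq : ∀ x y, (s x ^^ t x) ≠ (s i ^^ t i) → (s y ^^ t y) = (s i ^^ t i) → s x ≠ s y →
        t x = t y := by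
      intro x y h1 h2 h3
      rw [← h2] at h1
      revert h1 h3
      cases s x <;> cases t x <;> cases s y <;> cases t y <;> simp
    rintro ⟨x, y⟩ h ⟨x', y'⟩ h'
    simp only [Finset.mem_filter, Finset.mem_univ, true_and, not_not] at h h'
    obtain ⟨h1, h2, h3, h4⟩ := h
    obtain ⟨h1', h2', h3', h4'⟩ := h'
    have g := hteq x y h1 h2 h4
    have g' := hteq x' y' h1' h2' h4'
    rcases lt_or_gt_of_ne (fun e => h3.ne (D.inj e) : d x ≠ d y) with a | a <;>
    rcases lt_or_gt_of_ne (fun e => h3'.ne (D.inj e) : d x' ≠ d y') with a' | a'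
    · have := huniq _ _ _ _ h3 a g h3' a' g'
      rw [this.1, this.2]
    · have := huniq _ _ _ _ h3 a g h3'.symm a' g'.symm
      exact absurd h2' (this.1 ▸ h1)
    · have := huniq _ _ _ _ h3.symm a g.symm h3' a' g'
      exact absurd h2 (this.1 ▸ h1')
    · have := huniq _ _ _ _ h3.symm a g.symm h3'.symm a' g'.symm
      rw [this.1, this.2]

/-- Colouring the pieces properly, turning them so that at least half of the edges between them
are cut, and then improving by moves of single vertices, if possible, gives a large cut. -/
theorem three_mul_crossing_le (D : Decomposition G r d pa lab col) (hdeg : ∀ v, G.degree v ≤ 4)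
    {s₀ s : V → Bool} (hs : ∀ v w, lab v = lab w → (s₀ v = s₀ w ↔ col v = col w))
    (hbal : ((upDarts G d).filter fun p => lab p.1 ≠ lab p.2 ∧ s₀ p.1 = s₀ p.2).card ≤
      ((upDarts G d).filter fun p => lab p.1 ≠ lab p.2 ∧ s₀ p.1 ≠ s₀ p.2).card)
    (himp : crossing G d s₀ + 1 ≤ crossing G d s ∨
      s = s₀ ∧ ∀ v, innerDeg G s₀ v ≤ crossDeg G s₀ v) (t : V → Bool) :
    3 * crossing G d t ≤ 4 * crossing G d s := by
  set I := (upDarts G d).filter fun p => lab p.1 = lab p.2 with hI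
  have e1 : crossing G d s₀ = I.card +
      ((upDarts G d).filter fun p => lab p.1 ≠ lab p.2 ∧ s₀ p.1 ≠ s₀ p.2).card := by
    have h := Finset.card_filter_add_card_filter_not
      (s := (upDarts G d).filter fun p => s₀ p.1 ≠ s₀ p.2) (fun p => lab p.1 = lab p.2)
    rw [crossing, ← h, Finset.filter_filter, Finset.filter_filter, hI]
    congr 2
    · refine Finset.filter_congr fun p hp => and_iff_right_of_imp fun hl => ?_
      exact mt (hs _ _ hl).1 (D.proper _ _ (mem_upDarts.1 hp).1 hl)
    · exact Finset.filter_congr fun p hp => and_comm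
  have e2 : uncut G d s₀ =
      ((upDarts G d).filter fun p => lab p.1 ≠ lab p.2 ∧ s₀ p.1 = s₀ p.2).card := by
    rw [uncut]
    congr 1
    refine Finset.filter_congr fun p hp => ⟨fun h => ⟨fun hl => ?_, h⟩, fun h => h.2⟩
    exact D.proper _ _ (mem_upDarts.1 hp).1 hl ((hs _ _ hl).1 h)
  have e3 := Finset.card_le_card D.tree_darts_subset
  have e4 := card_tree_darts (pa := pa) (lab := lab)
  have e5 := D.card_pieces_le t
  have e6 := crossing_add_uncut (G := G) d t
  have e7 := crossing_add_uncut (G := G) d s₀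
  have e8 := two_mul_card_upDarts (G := G) D.inj
  have e9 : ∑ v, G.degree v ≤ ∑ v : V, 4 := Finset.sum_le_sum fun v _ => hdeg v
  have e9' : ∑ v : V, 4 = 4 * Fintype.card V := by simp [mul_comm]
  have e10 : crossing G d s₀ ≤ crossing G d s := by
    rcases himp with h | h
    · omega
    · rw [h.1]
  set N := (Finset.univ.filter fun v => lab v = v).card with hN
  have hNpos : 0 < N := Finset.card_pos.2 ⟨r, by simp [D.lab_root]⟩
  rw [← hI] at e3
  by_cases hN1 : N = 1
  · have : uncut G d s₀ = 0 := by
      have hr : ∀ v, lab v = r := by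
        intro v
        exact Finset.card_le_one.1 hN1.le _ (by simp [D.lab_lab]) _ (by simp [D.lab_root])
      rw [e2, Finset.card_eq_zero, Finset.filter_eq_empty_iff]
      intro p _ h
      exact h.1 ((hr _).trans (hr _).symm)
    omega
  -- The counts give `4 * crossing G d s₀ ≥ 3m - 2N` while `3 * crossing G d t = 3m - 3u` with `u =
  -- uncut G d t ≥ N - 1`. For `N ≥ 2`, `3u < 2N` only if `N = 2` and `u = 1`.
  by_cases htight : N = 2 ∧ uncut G d t = 1
  · by_contra hlt
    -- The deficit is less than one edge, so a gain of one edge would contradict `hlt`. Moreover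
    -- every estimate must be tight: the graph is `4`-regular and the pieces contain no edges but
    -- tree edges.
    have hopt := himp.resolve_left fun h => by omega
    have hcard : 4 * Fintype.card V = ∑ v, G.degree v := by omega
    have hIcard : I.card ≤ ((Finset.univ.filter fun v => lab v ≠ v).image
        fun v => (pa v, v)).card := by omega
    have hIeq := Finset.eq_of_subset_of_card_le D.tree_darts_subset hIcard
    have hreg : ∀ v, G.degree v = 4 := by
      intro v
      by_contra hv
      have := Finset.sum_lt_sum (fun v _ => hdeg v)
        ⟨v, Finset.mem_univ v, lt_of_le_of_ne (hdeg v) hv⟩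
      omega
    have := D.uncut_le_one_of_locally_optimal s₀ t hs hreg hopt.2 htight.1 ?_ htight.2.le
    · rw [hopt.1] at hlt
      omega
    · intro x y h1 h2 h3
      have : (x, y) ∈ I := Finset.mem_filter.2 ⟨mem_upDarts.2 ⟨h1, h2⟩, h3⟩
      rw [hI, ← hIeq] at this
      obtain ⟨v, hv, he⟩ := Finset.mem_image.1 this
      rw [Prod.mk.injEq] at he
      rw [← he.1, ← he.2]
      exact ⟨rfl, D.ne_root (Finset.mem_filter.1 hv).2⟩
  · omega

end Decomposition

end Approximation

/-! ### Search trees and the choice of the tree edges to be cut -/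

section SearchTrees

variable {V : Type*}

/-- `a` is a proper ancestor of `v` in the tree with root `r` and parents `pa`. -/
inductive Anc (r : V) (pa : V → V) : V → V → Prop
  | parent {v : V} : v ≠ r → Anc r pa (pa v) v
  | step {a v : V} : v ≠ r → Anc r pa a (pa v) → Anc r pa a v

/-- A depth first search tree: edges join vertices to their ancestors. The colouring `co` is the
proper colouring of the tree. -/
structure IsSearchTree (G : SimpleGraph V) (r : V) (d : V → ℕ) (pa : V → V) (co : V → Bool) :
    Prop where
  inj : Function.Injective d
  pos : ∀ v, 0 < d v
  adj : ∀ v, v ≠ r → G.Adj (pa v) v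
  lt : ∀ v, v ≠ r → d (pa v) < d v
  col_ne : ∀ v, v ≠ r → co (pa v) ≠ co v
  anc : ∀ u v, G.Adj u v → d u < d v → Anc r pa u v

/-- The edge from `y` to its ancestor `a` closes an odd cycle with the tree. -/
def Conflict (G : SimpleGraph V) (d : V → ℕ) (co : V → Bool) (y a : V) : Prop :=
  G.Adj y a ∧ d a < d y ∧ co a = co y

/-- The bottom-up choice of the tree edges to be cut, by processing the vertices with numbers
exceeding `i`: `H y` is the largest number of an ancestor to which an edge that closes an odd
cycle leads from the current piece of `y`, and the edge from `y` to its parent is cut if that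
ancestor is the parent. -/
structure IsCutMarking (G : SimpleGraph V) (r : V) (d : V → ℕ) (pa : V → V) (co : V → Bool)
    (i : ℕ) (H : V → ℕ) (C : V → Bool) [DecidableEq V] : Prop where
  conflict : ∀ y, i < d y → ∀ a, Conflict G d co y a → d a ≤ H y
  push : ∀ y, y ≠ r → i < d y → C y = false → H y ≤ H (pa y)
  attained : ∀ y, H y = 0 ∨ (∃ a, Conflict G d co y a ∧ H y = d a) ∨
    ∃ c, c ≠ r ∧ i < d c ∧ pa c = y ∧ C c = false ∧ H y = H c
  cut : ∀ y, i < d y → (C y = true ↔ H y = if y = r then 0 else d (pa y))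
  waiting : ∀ y, d y ≤ i → C y = false

/-- `lab` names the pieces left when the edges marked by `C` are cut. -/
def IsLabelling (pa : V → V) (C : V → Bool) (lab : V → V) : Prop :=
  ∀ v, (C v = true → lab v = v) ∧ (C v = false → lab v = lab (pa v))

variable {G : SimpleGraph V} {r : V} {d : V → ℕ} {pa lab : V → V} {co : V → Bool}

namespace IsSearchTree

theorem rec_tree (T : IsSearchTree G r d pa co) {P : V → Prop} (hr : P r)
    (hs : ∀ v, v ≠ r → P (pa v) → P v) (v : V) : P v := by
  induction h : d v using Nat.strong_induction_on generalizing v with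
  | _ k ih =>
    by_cases hv : v = r
    · exact hv ▸ hr
    · exact hs v hv (ih _ (h ▸ T.lt v hv) _ rfl)

theorem ne_root_of_anc {a v : V} (h : Anc r pa a v) : v ≠ r := by
  cases h <;> assumption

theorem le_of_anc (T : IsSearchTree G r d pa co) {a v : V} (h : Anc r pa a v) :
    d a ≤ d (pa v) := by
  induction h with
  | parent => exact le_rfl
  | step hv h ih => exact ih.trans (T.lt _ (ne_root_of_anc h)).le

theorem lt_of_anc (T : IsSearchTree G r d pa co) {a v : V} (h : Anc r pa a v) : d a < d v :=
  (T.le_of_anc h).trans_lt (T.lt _ (ne_root_of_anc h))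

variable {C : V → Bool} {H : V → ℕ}

theorem d_lab_le (T : IsSearchTree G r d pa co) (hl : IsLabelling pa C lab) (hr : C r = true)
    (v : V) : d (lab v) ≤ d v := by
  induction v using T.rec_tree with
  | hr => rw [(hl r).1 hr]
  | hs v hv ih =>
    cases h : C v
    · rw [(hl v).2 h]; exact ih.trans (T.lt v hv).le
    · rw [(hl v).1 h]

/-- The climb from `v` meets a cut edge before it reaches `a`, so the name of the piece of `v` lies
strictly below `a`. Hence bottom-up processing settles the piece of the lower end of an edge between
pieces before it reaches the upper end. -/
theorem lt_d_lab (T : IsSearchTree G r d pa co) (hl : IsLabelling pa C lab) {a v : V}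
    (h : Anc r pa a v) (hne : lab a ≠ lab v) : d a < d (lab v) := by
  induction h with
  | @parent v hv =>
    cases h : C v
    · exact absurd ((hl v).2 h).symm hne
    · rw [(hl v).1 h]; exact T.lt v hv
  | @step a v hv ha ih =>
    cases h : C v
    · rw [(hl v).2 h] at hne ⊢; exact ih hne
    · rw [(hl v).1 h]; exact T.lt_of_anc (.step hv ha)

variable [DecidableEq V]

/-- Follow the witness down through uncut children to the vertex where the edge starts. On the way
back up, the target stays a proper ancestor: a child whose target is its parent would have been cut.
Labels are only required to agree along uncut edges off the root, so that `cut_root` can apply this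
with a constant labelling. -/
theorem H_attained (T : IsSearchTree G r d pa co) (hC : IsCutMarking G r d pa co 0 H C)
    (hl : ∀ v, v ≠ r → C v = false → lab v = lab (pa v)) [Finite V] (y : V) :
    H y = 0 ∨ ∃ a x, Anc r pa a y ∧ H y = d a ∧ G.Adj a x ∧ co x = co a ∧ lab x = lab y := by
  obtain ⟨K, hK⟩ := (Set.finite_range d).bddAbove
  induction h : K - d y using Nat.strong_induction_on generalizing y with
  | _ k ih =>
    rcases hC.attained y with h0 | ⟨a, ⟨h1, h2, h3⟩, h4⟩ | ⟨c, h1, -, rfl, h4, h5⟩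
    · exact Or.inl h0
    · exact Or.inr ⟨a, y, T.anc a y h1.symm h2, h4, h1.symm, h3.symm, rfl⟩
    · have hK' := hK (Set.mem_range_self c)
      have hlt := T.lt c h1
      rcases ih (K - d c) (by omega) c rfl with h0 | ⟨a, x, g1, g2, g3, g4, g5⟩
      · exact Or.inl (h5.trans h0)
      · refine Or.inr ⟨a, x, ?_, h5.trans g2, g3, g4, g5.trans (hl c h1 h4)⟩
        have hne : ¬ H c = d (pa c) := by
          have := (hC.cut c (T.pos c)).not
          rw [h4, if_neg h1] at this
          simpa using this
        cases g1 with
        | parent => exact absurd g2 hne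
        | step _ g => exact g

/-- The root has no proper ancestor, so its value is `0`, which by convention means that it is cut.
-/
theorem cut_root (T : IsSearchTree G r d pa co) (hC : IsCutMarking G r d pa co 0 H C)
    [Finite V] : C r = true := by
  rw [hC.cut r (T.pos r), if_pos rfl]
  rcases T.H_attained hC (lab := fun _ => r) (fun _ _ _ => rfl) r with h | ⟨a, x, h, -⟩
  · exact h
  · exact absurd rfl (ne_root_of_anc h)

/-- While the climb from `y` towards `a` meets no cut edge, the value `H` does not decrease. At the
child of `a` it is therefore at least `d a`, and it is at most `d a` because it is the number of a
proper ancestor; so that edge is cut. -/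
theorem lab_ne (T : IsSearchTree G r d pa co) (hC : IsCutMarking G r d pa co 0 H C)
    (hl : IsLabelling pa C lab) [Finite V] {a y : V} (h : Anc r pa a y) (hle : d a ≤ H y) :
    lab a ≠ lab y := by
  have hlab := T.d_lab_le hl (T.cut_root hC)
  have hcut : ∀ {a v}, Anc r pa a v → C v = true → lab a ≠ lab v := by
    intro a v ha hv e
    have h1 := T.lt_of_anc ha
    have h2 := hlab a
    rw [e, (hl v).1 hv] at h2
    omega
  induction h with
  | @parent v hv =>
    refine hcut (.parent hv) ((hC.cut v (T.pos v)).2 ?_)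
    rw [if_neg hv]
    refine le_antisymm ?_ hle
    rcases T.H_attained hC (fun v _ => (hl v).2) v with h0 | ⟨a, x, h1, h2, -⟩
    · omega
    · rw [h2]; exact T.le_of_anc h1
  | @step a v hv ha ih =>
    cases h : C v
    · rw [(hl v).2 h]
      exact ih (hle.trans (hC.push v hv (T.pos v) h))
    · exact hcut (.step hv ha) h

/-- An edge inside a piece with equal parities would be a conflict, excluded by `lab_ne`. The odd
walk of a piece comes from the edge that caused its top to be cut. -/
theorem decomposition (T : IsSearchTree G r d pa co) (hC : IsCutMarking G r d pa co 0 H C)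
    (hl : IsLabelling pa C lab) [Finite V] : Decomposition G r d pa lab co where
  inj := T.inj
  adj := T.adj
  lt := T.lt
  col_ne := T.col_ne
  lab_root := (hl r).1 (T.cut_root hC)
  lab_eq v _ := by
    cases h : C v
    · exact Or.inr ((hl v).2 h)
    · exact Or.inl ((hl v).1 h)
  proper u v huv hlab e := by
    rcases lt_or_gt_of_ne (fun e => huv.ne (T.inj e) : d u ≠ d v) with h | h
    · exact T.lab_ne hC hl (T.anc u v huv h)
        (hC.conflict v (T.pos v) u ⟨huv.symm, h, e⟩) hlab
    · exact T.lab_ne hC hl (T.anc v u huv.symm h)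
        (hC.conflict u (T.pos u) v ⟨huv, h, e.symm⟩) hlab.symm
  odd v hv hlv := by
    have hcut : C v = true := by
      by_contra h
      have h1 := (hl v).2 (by simpa using h)
      have h2 := T.d_lab_le hl (T.cut_root hC) (pa v)
      rw [← h1, hlv] at h2
      exact absurd (T.lt v hv) (not_lt.2 h2)
    rw [hC.cut v (T.pos v), if_neg hv] at hcut
    rcases T.H_attained hC (fun v _ => (hl v).2) v with h0 | ⟨a, x, h1, h2, h3, h4, h5⟩
    · have := T.pos (pa v)
      omega
    · obtain rfl : a = pa v := T.inj (h2.symm.trans hcut)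
      exact ⟨x, h5.trans hlv, h3, h4⟩

end IsSearchTree

namespace IsCutMarking

variable [DecidableEq V] {H : V → ℕ} {C : V → Bool} {i h : ℕ} {y : V}

/-- One step of the bottom-up choice of the edges to be cut. The value `h` is the maximum of `H y`
and of the numbers of the ancestors of `y` to which edges closing odd cycles lead from `y`. -/
theorem succ (T : IsSearchTree G r d pa co) (hC : IsCutMarking G r d pa co (i + 1) H C)
    (hy : d y = i + 1) (h₁ : H y ≤ h) (h₂ : ∀ a, Conflict G d co y a → d a ≤ h)
    (h₃ : h = H y ∨ ∃ a, Conflict G d co y a ∧ h = d a) :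
    if h = (if y = r then 0 else d (pa y)) then
      IsCutMarking G r d pa co i (Function.update H y h) (Function.update C y true)
    else if y = r then IsCutMarking G r d pa co i (Function.update H y h) C
    else IsCutMarking G r d pa co i
      (Function.update (Function.update H y h) (pa y) (max (H (pa y)) h)) C := by
  have hlt : ∀ v, i < d v → v ≠ y → i + 1 < d v := fun v h1 h2 =>
    lt_of_le_of_ne h1 fun e => h2 (T.inj (e.symm.trans hy.symm))
  have hyC : C y = false := hC.waiting y hy.le
  -- Witnesses already in use are treated children, with numbers above `i + 1`; no update of this
  -- step touches them.
  have catt : ∀ (H' : V → ℕ) (C' : V → Bool), (∀ v, i + 1 < d v → H' v = H v ∧ C' v = C v) →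
      ∀ z, H z = 0 ∨ (∃ a, Conflict G d co z a ∧ H z = d a) ∨
        ∃ c, c ≠ r ∧ i < d c ∧ pa c = z ∧ C' c = false ∧ H z = H' c := by
    intro H' C' hH z
    rcases hC.attained z with h0 | h0 | ⟨c, c1, c2, c3, c4, c5⟩
    · exact Or.inl h0
    · exact Or.inr (Or.inl h0)
    · obtain ⟨e1, e2⟩ := hH c c2
      exact Or.inr (Or.inr ⟨c, c1, by omega, c3, e2 ▸ c4, e1 ▸ c5⟩)
  have hattY : ∀ (H' : V → ℕ) (C' : V → Bool), (∀ v, i + 1 < d v → H' v = H v ∧ C' v = C v) →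
      h = 0 ∨ (∃ a, Conflict G d co y a ∧ h = d a) ∨
        ∃ c, c ≠ r ∧ i < d c ∧ pa c = y ∧ C' c = false ∧ h = H' c := by
    intro H' C' hH
    rcases h₃ with rfl | h3
    · exact catt H' C' hH y
    · exact Or.inr (Or.inl h3)
  have hne : ∀ v, i + 1 < d v → v ≠ y := by rintro v hv rfl; omega
  by_cases hc : h = (if y = r then 0 else d (pa y))
  · rw [if_pos hc]
    have hH : ∀ v, i + 1 < d v →
        Function.update H y h v = H v ∧ Function.update C y true v = C v := fun v hv => by
      simp [hne v hv]
    refine ⟨?_, ?_, ?_, ?_, ?_⟩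
    · intro v hv a ha
      by_cases e : v = y
      · subst e; simpa using h₂ a ha
      · rw [Function.update_of_ne e]; exact hC.conflict v (hlt v hv e) a ha
    · intro v hvr hv hcv
      by_cases e : v = y
      · subst e; simp at hcv
      · rw [Function.update_of_ne e] at hcv ⊢
        have := hC.push v hvr (hlt v hv e) hcv
        by_cases e' : pa v = y
        · rw [e'] at this ⊢; simpa using this.trans h₁
        · rwa [Function.update_of_ne e']
    · intro z
      by_cases e : z = y
      · subst e; rw [Function.update_self]; exact hattY _ _ hH
      · rw [Function.update_of_ne e]; exact catt _ _ hH z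
    · intro v hv
      by_cases e : v = y
      · subst e; simpa using hc
      · rw [Function.update_of_ne e, Function.update_of_ne e]; exact hC.cut v (hlt v hv e)
    · intro v hv
      have e : v ≠ y := by rintro rfl; omega
      rw [Function.update_of_ne e]; exact hC.waiting v (by omega)
  rw [if_neg hc]
  by_cases hr : y = r
  · rw [if_pos hr]
    have hH : ∀ v, i + 1 < d v → Function.update H y h v = H v ∧ C v = C v := fun v hv => by
      simp [hne v hv]
    refine ⟨?_, ?_, ?_, ?_, ?_⟩
    · intro v hv a ha
      by_cases e : v = y
      · subst e; simpa using h₂ a ha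
      · rw [Function.update_of_ne e]; exact hC.conflict v (hlt v hv e) a ha
    · intro v hvr hv hcv
      have e : v ≠ y := by rintro rfl; exact hvr hr
      rw [Function.update_of_ne e]
      have := hC.push v hvr (hlt v hv e) hcv
      by_cases e' : pa v = y
      · rw [e'] at this ⊢; simpa using this.trans h₁
      · rwa [Function.update_of_ne e']
    · intro z
      by_cases e : z = y
      · subst e; rw [Function.update_self]; exact hattY _ _ hH
      · rw [Function.update_of_ne e]; exact catt _ _ hH z
    · intro v hv
      by_cases e : v = y
      · subst e; simpa [hyC] using hc
      · rw [Function.update_of_ne e]; exact hC.cut v (hlt v hv e)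
    · intro v hv
      exact hC.waiting v (by omega)
  · rw [if_neg hr]
    have hp : pa y ≠ y := fun e => (T.lt y hr).ne (by rw [e])
    have hdp := T.lt y hr
    have hH : ∀ v, i + 1 < d v →
        Function.update (Function.update H y h) (pa y) (max (H (pa y)) h) v = H v ∧ C v = C v :=
      fun v hv => by
        have : v ≠ pa y := by rintro rfl; omega
        simp [hne v hv, this]
    have hself : Function.update (Function.update H y h) (pa y) (max (H (pa y)) h) y = h := by
      rw [Function.update_of_ne hp.symm, Function.update_self]
    have hge : ∀ v, H v ≤ Function.update (Function.update H y h) (pa y) (max (H (pa y)) h) v := by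
      intro v
      by_cases e : v = pa y
      · subst e; simp
      rw [Function.update_of_ne e]
      by_cases e : v = y
      · subst e; simpa using h₁
      · rw [Function.update_of_ne e]
    refine ⟨?_, ?_, ?_, ?_, ?_⟩
    · intro v hv a ha
      by_cases e : v = y
      · subst e; rw [hself]; exact h₂ a ha
      · exact (hC.conflict v (hlt v hv e) a ha).trans (hge v)
    · intro v hvr hv hcv
      by_cases e : v = y
      · subst e; rw [hself, Function.update_self]; exact le_max_right _ _
      · rw [(hH v (hlt v hv e)).1]
        exact (hC.push v hvr (hlt v hv e) hcv).trans (hge _)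
    · intro z
      by_cases e : z = y
      · subst e; rw [hself]; exact hattY _ _ hH
      by_cases e' : z = pa y
      · subst e'
        have hval : Function.update (Function.update H y h) (pa y) (max (H (pa y)) h) (pa y) =
          max (H (pa y)) h := Function.update_self ..
        have hold := catt _ _ hH (pa y)
        rw [hval]
        generalize Function.update (Function.update H y h) (pa y) (max (H (pa y)) h) = F at *
        -- Either the old maximum at the parent survives with its old witness, or `y` becomes the
        -- witness.
        rcases le_total h (H (pa y)) with hle | hle
        · rw [max_eq_left hle]; exact hold
        · rw [max_eq_right hle]
          exact Or.inr (Or.inr ⟨y, hr, by omega, rfl, hyC, hself.symm⟩)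
      · rw [Function.update_of_ne e', Function.update_of_ne e]; exact catt _ _ hH z
    · intro v hv
      by_cases e : v = y
      · subst e; rw [hself]; simpa [hyC, hr] using hc
      · rw [(hH v (hlt v hv e)).1]; exact hC.cut v (hlt v hv e)
    · intro v hv
      exact hC.waiting v (by omega)

end IsCutMarking

end SearchTrees

/-! ### Turning the pieces -/

section Balancing

variable {V : Type*} [Fintype V] [DecidableEq V] (G : SimpleGraph V) [DecidableRel G.Adj]

/-- The edges from vertices of the piece `l` with numbers exceeding `i` up to vertices of other
pieces, turned according to `t`, that are cut (for `b = true`) or not cut (for `b = false`) if the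
piece `l` is not turned. -/
def turnDarts (d : V → ℕ) (lab : V → V) (co t : V → Bool) (i : ℕ) (l : V) (b : Bool) :
    Finset (V × V) :=
  Finset.univ.filter fun p => lab p.1 = l ∧ i < d p.1 ∧ G.Adj p.1 p.2 ∧ d p.1 < d p.2 ∧
    lab p.2 ≠ lab p.1 ∧ (co p.1 ^^ co p.2 ^^ t (lab p.2)) = b

/-- The vertices counted in one step of the computation of the sizes of `turnDarts`. -/
def turnNeighbors (d : V → ℕ) (lab : V → V) (co t : V → Bool) (y : V) (b : Bool) : Finset V :=
  Finset.univ.filter fun z => G.Adj y z ∧ d y < d z ∧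
    lab z ≠ lab y ∧ (co y ^^ co z ^^ t (lab z)) = b

/-- Bottom-up, the pieces are turned so that at least half of the edges to the pieces treated
before are cut. -/
structure IsBalancing (d : V → ℕ) (lab : V → V) (co C : V → Bool) (i : ℕ) (good bad : V → ℕ)
    (t : V → Bool) : Prop where
  good_eq : ∀ l, good l = (turnDarts G d lab co t i l true).card
  bad_eq : ∀ l, bad l = (turnDarts G d lab co t i l false).card
  turn : ∀ l, i < d l → C l = true → (t l = true ↔ good l < bad l)
  waiting : ∀ l, d l ≤ i → t l = false

variable {G} {r y : V} {d good bad : V → ℕ} {pa lab : V → V} {co C t t' : V → Bool} {i : ℕ}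

namespace IsSearchTree

/-- By `lt_d_lab`, the counted edges lead to pieces whose names exceed `i + 1`, so turning pieces
with smaller names does not affect the count. -/
theorem turnDarts_congr (T : IsSearchTree G r d pa co) (hl : IsLabelling pa C lab)
    (h : ∀ v, t' v = t v ∨ d v ≤ i + 1) (l : V) (b : Bool) :
    turnDarts G d lab co t' i l b = turnDarts G d lab co t i l b := by
  refine Finset.filter_congr fun p _ => ?_
  refine and_congr_right fun _ => and_congr_right fun h1 => and_congr_right fun h2 =>
    and_congr_right fun h3 => and_congr_right fun h4 => ?_
  have := T.lt_d_lab hl (T.anc _ _ h2 h3) (Ne.symm h4)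
  rw [(h (lab p.2)).resolve_right (by omega)]

theorem card_turnDarts (T : IsSearchTree G r d pa co) (hy : d y = i + 1) (l : V) (b : Bool) :
    (turnDarts G d lab co t i l b).card = (turnDarts G d lab co t (i + 1) l b).card +
      if l = lab y then (turnNeighbors G d lab co t y b).card else 0 := by
  have h := Finset.card_filter_add_card_filter_not
    (s := turnDarts G d lab co t i l b) (fun p => p.1 ≠ y)
  have e1 : (turnDarts G d lab co t i l b).filter (fun p => p.1 ≠ y) =
      turnDarts G d lab co t (i + 1) l b := by
    ext p
    simp only [turnDarts, Finset.mem_filter, Finset.mem_univ, true_and]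
    have : i + 1 < d p.1 ↔ i < d p.1 ∧ p.1 ≠ y := by
      constructor
      · intro h; exact ⟨by omega, by rintro e; rw [e] at h; omega⟩
      · rintro ⟨h1, h2⟩
        exact lt_of_le_of_ne h1 fun e => h2 (T.inj (e.symm.trans hy.symm))
    rw [this]
    tauto
  have e2 : ((turnDarts G d lab co t i l b).filter fun p => ¬ p.1 ≠ y).card =
      if l = lab y then (turnNeighbors G d lab co t y b).card else 0 := by
    split_ifs with hl
    · symm
      refine Finset.card_bij (fun z _ => (y, z)) ?_ ?_ ?_
      · intro z hz
        simp only [turnNeighbors, Finset.mem_filter, Finset.mem_univ, true_and] at hz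
        simp only [turnDarts, Finset.mem_filter, Finset.mem_univ, true_and, not_not, and_true]
        exact ⟨hl.symm, by omega, hz⟩
      · intro z _ z' _ e; simpa using e
      · rintro ⟨a, z⟩ hp
        simp only [turnDarts, Finset.mem_filter, Finset.mem_univ, true_and, not_not] at hp
        obtain ⟨hp, rfl⟩ := hp
        exact ⟨z, by simpa [turnNeighbors] using hp.2.2, rfl⟩
    · rw [Finset.card_eq_zero, Finset.filter_eq_empty_iff]
      intro p hp
      simp only [turnDarts, Finset.mem_filter, Finset.mem_univ, true_and] at hp
      rw [not_not]
      rintro rfl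
      exact hl hp.1.symm
  rw [← h, e1, e2]

end IsSearchTree

/-- The name of a piece is its vertex of least number, hence treated last. When `y` names its piece,
the counts are complete and the decision about turning it is final. -/
theorem IsBalancing.succ (T : IsSearchTree G r d pa co) (hl : IsLabelling pa C lab)
    (hr : C r = true) (hB : IsBalancing G d lab co C (i + 1) good bad t) (hy : d y = i + 1) :
    let good' := Function.update good (lab y)
      (good (lab y) + (turnNeighbors G d lab co t y true).card)
    let bad' := Function.update bad (lab y)
      (bad (lab y) + (turnNeighbors G d lab co t y false).card)
    IsBalancing G d lab co C i good' bad'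
      (if C y = true ∧ good' (lab y) < bad' (lab y) then Function.update t y true else t) := by
  intro good' bad'
  set t' := if C y = true ∧ good' (lab y) < bad' (lab y) then Function.update t y true else t
    with ht'
  have htt : ∀ v, t' v = t v ∨ v = y := by
    intro v
    rw [ht']
    split_ifs
    · by_cases e : v = y
      · exact Or.inr e
      · exact Or.inl (Function.update_of_ne e _ _)
    · exact Or.inl rfl
  have htd : ∀ v, t' v = t v ∨ d v ≤ i + 1 := fun v => (htt v).imp id (by rintro rfl; omega)
  have hup : ∀ (f : V → ℕ) (b : Bool) (l : V),
      (∀ l, f l = (turnDarts G d lab co t (i + 1) l b).card) →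
      Function.update f (lab y) (f (lab y) + (turnNeighbors G d lab co t y b).card) l =
        (turnDarts G d lab co t' i l b).card := by
    intro f b l hf
    rw [T.turnDarts_congr hl htd, T.card_turnDarts hy]
    by_cases e : l = lab y
    · rw [e, if_pos rfl, Function.update_self, hf]
    · rw [if_neg e, Function.update_of_ne e, hf, add_zero]
  refine ⟨fun l => hup good true l hB.good_eq, fun l => hup bad false l hB.bad_eq, ?_, ?_⟩
  · intro l hil hlC
    by_cases e : l = y
    · subst e
      have hlab := (hl l).1 hlC
      have hw := hB.waiting l hy.le
      rw [ht', hlab]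
      by_cases hlt : good' l < bad' l
      · simp [hlC, hlt]
      · simp [hlt, hw]
    · have hlt : i + 1 < d l := lt_of_le_of_ne hil fun e' => e (T.inj (e'.symm.trans hy.symm))
      have hne : l ≠ lab y := by
        have := T.d_lab_le hl hr y
        rintro rfl; omega
      rw [(htt l).resolve_right e, hB.turn l hlt hlC]
      simp only [good', bad', Function.update_of_ne hne]
  · intro l hil
    rw [(htt l).resolve_right (by rintro rfl; omega)]
    exact hB.waiting l (by omega)

/-- Group the edges between pieces by the piece of the end with the smaller number. Turning that
piece exchanges its counts `good` and `bad`, and it was turned exactly if `bad` was larger. -/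
theorem IsBalancing.card_le (T : IsSearchTree G r d pa co) (hl : IsLabelling pa C lab)
    (hr : C r = true) (hB : IsBalancing G d lab co C 0 good bad t) :
    ((upDarts G d).filter fun p => lab p.1 ≠ lab p.2 ∧
        (co p.1 ^^ t (lab p.1)) = (co p.2 ^^ t (lab p.2))).card ≤
      ((upDarts G d).filter fun p => lab p.1 ≠ lab p.2 ∧
        (co p.1 ^^ t (lab p.1)) ≠ (co p.2 ^^ t (lab p.2))).card := by
  have hcut : ∀ v, C (lab v) = true := by
    intro v
    induction v using T.rec_tree with
    | hr => rw [(hl r).1 hr, hr]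
    | hs v hv ih =>
      cases h : C v
      · rw [(hl v).2 h, ih]
      · rw [(hl v).1 h, h]
  have key : ∀ (c : Bool), ((upDarts G d).filter fun p => lab p.1 ≠ lab p.2 ∧
        ((co p.1 ^^ t (lab p.1)) ^^ (co p.2 ^^ t (lab p.2))) = c).card =
      ∑ l, (turnDarts G d lab co t 0 l (c ^^ t l)).card := by
    intro c
    rw [Finset.card_eq_sum_card_fiberwise (f := fun p => lab p.1) (t := Finset.univ)
      (fun _ _ => by simp)]
    refine Finset.sum_congr rfl fun l _ => ?_
    congr 1
    ext p
    simp only [turnDarts, Finset.mem_filter, mem_upDarts, Finset.mem_univ, true_and]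
    have hpos := T.pos p.1
    constructor
    · rintro ⟨⟨⟨h1, h2⟩, h3, h4⟩, rfl⟩
      refine ⟨rfl, hpos, h1, h2, Ne.symm h3, ?_⟩
      rw [← h4]
      cases co p.1 <;> cases co p.2 <;> cases t (lab p.1) <;> cases t (lab p.2) <;> rfl
    · rintro ⟨rfl, -, h1, h2, h3, h4⟩
      refine ⟨⟨⟨h1, h2⟩, Ne.symm h3, ?_⟩, rfl⟩
      revert h4
      cases co p.1 <;> cases co p.2 <;> cases t (lab p.1) <;> cases t (lab p.2) <;> cases c <;> simp
  have k0 := key false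
  have k1 := key true
  have x0 : ∀ a b : Bool, (a ^^ b) = false ↔ a = b := by decide
  have x1 : ∀ a b : Bool, (a ^^ b) = true ↔ a ≠ b := by decide
  simp only [x0, x1] at k0 k1
  rw [k0, k1]
  refine Finset.sum_le_sum fun l _ => ?_
  by_cases hlC : C l = true
  · have h1 := hB.turn l (T.pos l) hlC
    rw [hB.good_eq, hB.bad_eq] at h1
    cases h : t l
    · rw [h] at h1
      simpa using h1
    · rw [h] at h1
      simpa using (h1.1 rfl).le
  · have : turnDarts G d lab co t 0 l (false ^^ t l) = ∅ := by
      rw [turnDarts, Finset.filter_eq_empty_iff]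
      rintro p _ ⟨rfl, -⟩
      exact hlC (hcut p.1)
    rw [this]
    simp

end Balancing

/-! ### Depth first search as a transition system -/

section Search

variable {V : Type*} [Fintype V]

/-- A stage of a depth first search: `k` vertices have been found, those in `R` have been left for
good, and the search has come to `cur` or has ended. -/
structure IsPartialSearch (G : SimpleGraph V) (r : V) (k : ℕ) (d : V → ℕ) (pa : V → V)
    (co : V → Bool) (R : Finset V) (cur : Option V) : Prop where
  root : d r = 1
  le : ∀ v, d v ≤ k
  inj : ∀ u v, d u ≠ 0 → d u = d v → u = v
  card : (Finset.univ.filter fun v => d v ≠ 0).card = k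
  tree : ∀ v, v ≠ r → d v ≠ 0 → G.Adj (pa v) v ∧ d (pa v) ≠ 0 ∧ d (pa v) < d v ∧ co (pa v) ≠ co v
  fresh : ∀ v, d v = 0 → co v = false
  anc : ∀ u v, G.Adj u v → d u ≠ 0 → d u < d v → Anc r pa u v
  retired : ∀ u ∈ R, d u ≠ 0 ∧ ∀ w, G.Adj u w → d w ≠ 0
  path : ∀ u, d u ≠ 0 → u ∉ R → cur = some u ∨ ∃ c, cur = some c ∧ Anc r pa u c
  current : ∀ c, cur = some c → d c ≠ 0 ∧ c ∉ R ∧ ∀ u, Anc r pa u c → u ∉ R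

namespace IsPartialSearch

variable {G : SimpleGraph V} {r c f : V} {k : ℕ} {d : V → ℕ} {pa : V → V} {co : V → Bool}
  {R : Finset V} {cur : Option V}

theorem start [DecidableEq V] (G : SimpleGraph V) (r : V) :
    IsPartialSearch G r 1 (Function.update 0 r 1) (fun _ => r) (fun _ => false) ∅ (some r) := by
  have h : ∀ v, Function.update (0 : V → ℕ) r 1 v = if v = r then 1 else 0 := by
    intro v; by_cases e : v = r <;> simp [e]
  have h' : ∀ v, Function.update (0 : V → ℕ) r 1 v ≠ 0 → v = r := by
    intro v; rw [h]; split_ifs <;> simp_all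
  refine ⟨by simp, ?_, ?_, ?_, ?_, by simp, ?_, by simp, ?_, by simp⟩
  · intro v; rw [h]; split_ifs <;> simp
  · intro u v h1 h2
    rw [h' u h1, h' v (h2 ▸ h1)]
  · rw [Finset.card_eq_one]
    refine ⟨r, ?_⟩
    ext v; simp [h]
  · intro v hv h1; exact absurd (h' v h1) hv
  · intro u v _ h1 h2
    have := h' v (by omega)
    rw [h' u h1, this] at h2
    omega
  · intro u hu _; exact Or.inl (by rw [h' u hu])

theorem lt_of_anc (S : IsPartialSearch G r k d pa co R cur) {a v : V} (h : Anc r pa a v)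
    (hv : d v ≠ 0) : d a ≠ 0 ∧ d a < d v := by
  induction h with
  | parent h => exact ⟨(S.tree _ h hv).2.1, (S.tree _ h hv).2.2.1⟩
  | step h _ ih =>
    have h1 := S.tree _ h hv
    exact ⟨(ih h1.2.1).1, (ih h1.2.1).2.trans h1.2.2.1⟩

theorem anc_update [DecidableEq V] (S : IsPartialSearch G r k d pa co R cur) (hf : d f = 0)
    {a v : V} (h : Anc r pa a v) (hv : d v ≠ 0) : Anc r (Function.update pa f c) a v := by
  induction h with
  | @parent v h =>
    have e : Function.update pa f c v = pa v :=
      Function.update_of_ne (by rintro rfl; exact hv hf) _ _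
    rw [← e]
    exact .parent h
  | @step a v h _ ih =>
    have e : Function.update pa f c v = pa v :=
      Function.update_of_ne (by rintro rfl; exact hv hf) _ _
    refine .step h ?_
    rw [e]
    exact ih (S.tree _ h hv).2.1

theorem of_anc_update [DecidableEq V] (S : IsPartialSearch G r k d pa co R cur) (hf : d f = 0)
    {a v : V} (h : Anc r (Function.update pa f c) a v) (hv : d v ≠ 0) : Anc r pa a v := by
  induction h with
  | @parent v h =>
    have e : Function.update pa f c v = pa v :=
      Function.update_of_ne (by rintro rfl; exact hv hf) _ _
    rw [e]
    exact .parent h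
  | @step a v h _ ih =>
    have e : Function.update pa f c v = pa v :=
      Function.update_of_ne (by rintro rfl; exact hv hf) _ _
    refine .step h ?_
    rw [e] at ih
    exact ih (S.tree _ h hv).2.1

/-- A visited neighbour of the new vertex `f` has not been retired, since retired vertices have only
visited neighbours. It therefore lies on the path from the root to `c`, and becomes an ancestor of
`f`. This is why every edge ends up joining a vertex to an ancestor. -/
theorem visit [DecidableEq V] (S : IsPartialSearch G r k d pa co R (some c)) (hcf : G.Adj c f)
    (hf : d f = 0) :
    IsPartialSearch G r (k + 1) (Function.update d f (k + 1)) (Function.update pa f c)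
      (Function.update co f (!co c)) R (some f) := by
  obtain ⟨hc1, hc2, hc3⟩ := S.current c rfl
  have hcf' : c ≠ f := hcf.ne
  have hfr : f ≠ r := by rintro rfl; rw [S.root] at hf; omega
  have old : ∀ v, v ≠ f → Function.update d f (k + 1) v = d v := fun v h =>
    Function.update_of_ne h _ _
  have hne : ∀ v, d v ≠ 0 → v ≠ f := by rintro v hv rfl; exact hv hf
  have hpf : Function.update pa f c f = c := Function.update_self ..
  have hancf : ∀ u, u = c ∨ Anc r pa u c → Anc r (Function.update pa f c) u f := by
    rintro u (rfl | h)
    · conv => arg 3; rw [← Function.update_self f u pa]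
      exact .parent hfr
    · exact .step hfr (hpf.symm ▸ S.anc_update hf h hc1)
  have honpath : ∀ u, d u ≠ 0 → u ∉ R → u = c ∨ Anc r pa u c := by
    intro u h1 h2
    rcases S.path u h1 h2 with h | ⟨c', h, h'⟩
    · exact Or.inl (Option.some.inj h).symm
    · obtain rfl := Option.some.inj h
      exact Or.inr h'
  refine ⟨?_, ?_, ?_, ?_, ?_, ?_, ?_, ?_, ?_, ?_⟩
  · rw [old r hfr.symm, S.root]
  · intro v
    by_cases e : v = f
    · rw [e, Function.update_self]
    · rw [old v e]; exact (S.le v).trans (Nat.le_succ k)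
  · intro u v h1 h2
    have hu := S.le u
    have hv := S.le v
    by_cases e : u = f <;> by_cases e' : v = f
    · rw [e, e']
    · rw [e, Function.update_self, old v e'] at h2; omega
    · rw [e', Function.update_self, old u e] at h2; omega
    · rw [old u e] at h1 h2
      rw [old v e'] at h2
      exact S.inj u v h1 h2
  · have : (Finset.univ.filter fun v => Function.update d f (k + 1) v ≠ 0) =
        insert f (Finset.univ.filter fun v => d v ≠ 0) := by
      ext v
      by_cases e : v = f
      · simp [e]
      · simp [e]
    rw [this, Finset.card_insert_of_notMem (by simp [hf]), S.card]
  · intro v hvr hv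
    by_cases e : v = f
    · subst e
      rw [hpf, Function.update_self, old c hcf', Function.update_self,
        Function.update_of_ne hcf']
      refine ⟨hcf, hc1, Nat.lt_succ_of_le (S.le c), ?_⟩
      cases co c <;> simp
    · rw [old v e] at hv ⊢
      obtain ⟨h1, h2, h3, h4⟩ := S.tree v hvr hv
      rw [Function.update_of_ne e, old _ (hne _ h2), Function.update_of_ne e,
        Function.update_of_ne (hne _ h2)]
      exact ⟨h1, h2, h3, h4⟩
  · intro v hv
    have e : v ≠ f := by rintro rfl; simp at hv
    rw [old v e] at hv
    rw [Function.update_of_ne e]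
    exact S.fresh v hv
  · intro u v huv h1 h2
    have hv := S.le v
    by_cases e : u = f
    · subst e
      rw [Function.update_self, old v huv.ne'] at h2
      omega
    rw [old u e] at h1 h2
    by_cases e' : v = f
    · subst e'
      refine hancf u (honpath u h1 fun hR => ?_)
      exact (S.retired u hR).2 v huv hf
    · rw [old v e'] at h2
      exact S.anc_update hf (S.anc u v huv h1 h2) (by omega)
  · intro u hu
    obtain ⟨h1, h2⟩ := S.retired u hu
    refine ⟨by rwa [old u (hne u h1)], fun w hw => ?_⟩
    have := h2 w hw
    rwa [old w (hne w this)]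
  · intro u h1 h2
    by_cases e : u = f
    · exact Or.inl (by rw [e])
    · rw [old u e] at h1
      exact Or.inr ⟨f, rfl, hancf u (honpath u h1 h2)⟩
  · rintro c' h
    obtain rfl := Option.some.inj h
    refine ⟨by simp, fun hR => (S.retired _ hR).1 hf, fun u hu => ?_⟩
    have : u = c ∨ Anc r pa u c := by
      cases hu with
      | parent => exact Or.inl hpf
      | step _ h => rw [hpf] at h; exact Or.inr (S.of_anc_update hf h hc1)
    rcases this with rfl | h
    · exact hc2
    · exact hc3 u h

/-- The current vertex may be retired once all its neighbours are visited. The active vertices are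
then the parent and its ancestors, or none if the root was retired. -/
theorem retreat [DecidableEq V] (S : IsPartialSearch G r k d pa co R (some c))
    (hc : ∀ w, G.Adj c w → d w ≠ 0) :
    c ∉ R ∧ IsPartialSearch G r k d pa co (insert c R) (if c = r then none else some (pa c)) := by
  obtain ⟨hc1, hc2, hc3⟩ := S.current c rfl
  refine ⟨hc2, S.root, S.le, S.inj, S.card, S.tree, S.fresh, S.anc, ?_, ?_, ?_⟩
  · intro u hu
    rcases Finset.mem_insert.1 hu with rfl | h
    · exact ⟨hc1, hc⟩
    · exact S.retired u h
  · intro u h1 h2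
    rw [Finset.mem_insert, not_or] at h2
    rcases S.path u h1 h2.2 with h | ⟨c', h, h'⟩
    · exact absurd (Option.some.inj h).symm h2.1
    · obtain rfl := Option.some.inj h
      cases h' with
      | parent hr => exact Or.inl (by rw [if_neg hr])
      | step hr h => exact Or.inr ⟨pa c, by rw [if_neg hr], h⟩
  · intro c' h
    split_ifs at h with hr
    obtain rfl := Option.some.inj h
    obtain ⟨t1, t2, t3, t4⟩ := S.tree c hr hc1
    refine ⟨t2, ?_, fun u hu => ?_⟩
    · rw [Finset.mem_insert, not_or]
      exact ⟨fun e => t3.ne (by rw [e]), hc3 _ (.parent hr)⟩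
    · rw [Finset.mem_insert, not_or]
      refine ⟨?_, hc3 _ (.step hr hu)⟩
      rintro rfl
      have := (S.lt_of_anc hu t2).2
      omega

/-- Bounds the number of steps still to come. -/
theorem card_add_card_le (S : IsPartialSearch G r k d pa co R cur) :
    k + R.card ≤ 2 * Fintype.card V := by
  have h1 := Finset.card_le_univ R
  have h2 := Finset.card_le_univ (Finset.univ.filter fun v => d v ≠ 0)
  rw [S.card] at h2
  omega

/-- When the search has ended, all visited vertices are retired, so being visited spreads along
walks and connectedness makes every vertex visited. The numbering is then a bijection onto `1, …,
n`. -/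
theorem isSearchTree (S : IsPartialSearch G r k d pa co R none) (hG : G.Preconnected) :
    IsSearchTree G r d pa co ∧ (∀ v, d v ≤ Fintype.card V) ∧
      ∀ i, 0 < i → i ≤ Fintype.card V → ∃ v, d v = i := by
  have hR : ∀ v, d v ≠ 0 → v ∈ R := by
    intro v hv
    by_contra h
    rcases S.path v hv h with h | ⟨c, h, -⟩ <;> cases h
  have hall : ∀ v, d v ≠ 0 := by
    intro v
    obtain ⟨w⟩ := hG r v
    have : ∀ u v, G.Walk u v → d u ≠ 0 → d v ≠ 0 := by
      intro u v w
      induction w with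
      | nil => exact id
      | cons h _ ih => exact fun hu => ih ((S.retired _ (hR _ hu)).2 _ h)
    exact this r v w (by rw [S.root]; omega)
  have hk : k = Fintype.card V := by
    rw [← S.card, Finset.filter_true_of_mem fun v _ => hall v, Finset.card_univ]
  have hinj : Function.Injective d := fun u v h => S.inj u v (hall u) h
  refine ⟨⟨hinj, fun v => Nat.pos_of_ne_zero (hall v),
    fun v hv => (S.tree v hv (hall v)).1, fun v hv => (S.tree v hv (hall v)).2.2.1,
    fun v hv => (S.tree v hv (hall v)).2.2.2, fun u v h h' => S.anc u v h (hall u) h'⟩,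
    fun v => hk ▸ S.le v, fun i h1 h2 => ?_⟩
  have h3 : Finset.univ.image d = Finset.Icc 1 (Fintype.card V) := by
    refine Finset.eq_of_subset_of_card_le ?_ ?_
    · intro j hj
      obtain ⟨v, -, rfl⟩ := Finset.mem_image.1 hj
      exact Finset.mem_Icc.2 ⟨Nat.pos_of_ne_zero (hall v), hk ▸ S.le v⟩
    · rw [Finset.card_image_of_injective _ hinj]; simp
  have h4 : i ∈ Finset.univ.image d := h3 ▸ Finset.mem_Icc.2 ⟨h1, h2⟩
  obtain ⟨v, -, hv⟩ := Finset.mem_image.1 h4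
  exact ⟨v, hv⟩

end IsPartialSearch

end Search

/-! ### Running programs without loops, bounded loops, and scans -/

namespace RAM

instance (b : Test) (s : State) : Decidable (b.Holds s) := by
  cases b <;> unfold Test.Holds <;> infer_instance

/-- The final state of a program without loops. -/
def Prog.sem : Prog → State → State
  | .skip, s => s
  | .instr I, s => I.eval s
  | .seq p q, s => q.sem (p.sem s)
  | .ite b p q, s => if b.Holds s then p.sem s else q.sem s
  | .loop _ _, s => s

def Prog.LoopFree : Prog → Prop
  | .skip => True
  | .instr _ => True
  | .seq p q => p.LoopFree ∧ q.LoopFree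
  | .ite _ p q => p.LoopFree ∧ q.LoopFree
  | .loop _ _ => False

/-- A bound for the number of steps of a program without loops. -/
def Prog.cost : Prog → ℕ
  | .skip => 1
  | .instr _ => 1
  | .seq p q => p.cost + q.cost
  | .ite _ p q => p.cost + q.cost + 1
  -- A dummy value: the bound is used only for programs without loops.
  | .loop _ _ => 0

theorem Prog.LoopFree.exec {p : Prog} (hp : p.LoopFree) (s : State) :
    ∃ t, Exec p s (p.sem s) t ∧ t ≤ p.cost := by
  induction p generalizing s with
  | skip => exact ⟨1, .skip s, le_rfl⟩
  | instr I => exact ⟨1, .instr I s, le_rfl⟩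
  | seq p q ihp ihq =>
    obtain ⟨t, h, ht⟩ := ihp hp.1 s
    obtain ⟨t', h', ht'⟩ := ihq hp.2 (p.sem s)
    exact ⟨t + t', .seq h h', add_le_add ht ht'⟩
  | ite b p q ihp ihq =>
    by_cases hb : b.Holds s
    · obtain ⟨t, h, ht⟩ := ihp hp.1 s
      refine ⟨t + 1, ?_, by simp only [Prog.cost]; omega⟩
      rw [Prog.sem, if_pos hb]
      exact .ite_true hb h
    · obtain ⟨t, h, ht⟩ := ihq hp.2 s
      refine ⟨t + 1, ?_, by simp only [Prog.cost]; omega⟩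
      rw [Prog.sem, if_neg hb]
      exact .ite_false hb h
  | loop b p => exact hp.elim

/-- A loop whose body has no loops, with an invariant that bounds the number of rounds to come. -/
theorem exec_loop {b : Test} {p : Prog} (hp : p.LoopFree) (I : ℕ → State → Prop)
    (hI : ∀ k s, I k s → b.Holds s → ∃ k' < k, I k' (p.sem s)) (k : ℕ) (s : State) (hs : I k s) :
    ∃ s' t, Exec (.loop b p) s s' t ∧ t ≤ (p.cost + 1) * k + 1 ∧ ¬ b.Holds s' ∧ ∃ k', I k' s' := by
  induction k using Nat.strong_induction_on generalizing s with
  | _ k ih =>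
    by_cases hb : b.Holds s
    · obtain ⟨k', hk, hI'⟩ := hI k s hs hb
      obtain ⟨t, h, ht⟩ := hp.exec s
      obtain ⟨s', t', h', ht', hb', hI''⟩ := ih k' hk _ hI'
      refine ⟨s', t + t' + 1, .loop_true hb h h', ?_, hb', hI''⟩
      have : (p.cost + 1) * (k' + 1) ≤ (p.cost + 1) * k := Nat.mul_le_mul_left _ hk
      rw [mul_add, mul_one] at this
      omega
    · exact ⟨s, 1, .loop_false hb, by omega, hb, k, hs⟩

@[simp] theorem sem_skip (s : State) : Prog.skip.sem s = s := rfl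

@[simp] theorem sem_seq (p q : Prog) (s : State) : (Prog.seq p q).sem s = q.sem (p.sem s) := rfl

@[simp] theorem sem_ite_eq (x y : ℕ) (p q : Prog) (s : State) :
    (Prog.ite (.eq x y) p q).sem s = if s.reg x = s.reg y then p.sem s else q.sem s := by
  simp only [Prog.sem, Test.Holds]

@[simp] theorem sem_ite_ne (x y : ℕ) (p q : Prog) (s : State) :
    (Prog.ite (.ne x y) p q).sem s = if s.reg x ≠ s.reg y then p.sem s else q.sem s := by
  simp only [Prog.sem, Test.Holds]

@[simp] theorem sem_ite_lt (x y : ℕ) (p q : Prog) (s : State) :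
    (Prog.ite (.lt x y) p q).sem s = if s.reg x < s.reg y then p.sem s else q.sem s := by
  simp only [Prog.sem, Test.Holds]

/-- A list of instructions as a program. -/
def block : List Instr → Prog
  | [] => .skip
  | I :: l => .seq (.instr I) (block l)

theorem block_loopFree (l : List Instr) : (block l).LoopFree := by
  induction l with
  | nil => trivial
  | cons I l ih => exact ⟨trivial, ih⟩

@[simp] theorem sem_block_nil (s : State) : (block []).sem s = s := rfl

@[simp] theorem sem_block_cons (I : Instr) (l : List Instr) (s : State) :
    (block (I :: l)).sem s = (block l).sem (I.eval s) := rfl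

/-- Unrolling keeps scans free of loops, so that each has a constant cost. -/
def repeatProg : ℕ → Prog → Prog
  | 0, _ => .skip
  | k + 1, p => .seq p (repeatProg k p)

/-- Runs `body` for all entries (at most four) of the adjacency list of the vertex in register `1`,
with the entry in register `4`. -/
def scan (body : Prog) : Prog :=
  .seq (block [.copy 3 1, .inc 3, .load 3 0 3, .load 2 0 1])
    (repeatProg 4 (.ite (.lt 2 3) (.seq (block [.load 4 1 2]) (.seq body (block [.inc 2]))) .skip))

theorem scan_loopFree {body : Prog} (h : body.LoopFree) : (scan body).LoopFree := by
  simp [scan, repeatProg, Prog.LoopFree, block_loopFree, h]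

/-- The registers that keep their contents during a scan. -/
def Kept (r : ℕ) : Prop := r ≤ 1 ∨ 7 ≤ r ∧ r < 20

/-- The body of a scan, for the entry `z`, changes only auxiliary registers, and the registers `5`
and `6` according to `f`. -/
def IsScanBody {n : ℕ} (body : Prog) (s : State) (f : Fin n → ℕ × ℕ → ℕ × ℕ) : Prop :=
  ∀ s' : State, ∀ z : Fin n, s'.arr = s.arr → (∀ r, Kept r → s'.reg r = s.reg r) → s'.reg 4 = z →
    (body.sem s').arr = s.arr ∧ (∀ r < 4, (body.sem s').reg r = s'.reg r) ∧
    (∀ r, Kept r → (body.sem s').reg r = s.reg r) ∧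
    ((body.sem s').reg 5, (body.sem s').reg 6) = f z (s'.reg 5, s'.reg 6)

/-- The instruction changes no array, and at most a register with auxiliary contents. -/
def Instr.IsAuxiliary : Instr → Prop
  | .const x _ => x = 5 ∨ x = 6 ∨ 20 ≤ x
  | .copy x _ => x = 5 ∨ x = 6 ∨ 20 ≤ x
  | .inc x => x = 5 ∨ x = 6 ∨ 20 ≤ x
  | .dec x => x = 5 ∨ x = 6 ∨ 20 ≤ x
  | .load x _ _ => x = 5 ∨ x = 6 ∨ 20 ≤ x
  | .store _ _ _ => False

def Prog.IsAuxiliary : Prog → Prop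
  | .skip => True
  | .instr I => I.IsAuxiliary
  | .seq p q => p.IsAuxiliary ∧ q.IsAuxiliary
  | .ite _ p q => p.IsAuxiliary ∧ q.IsAuxiliary
  | .loop _ _ => True

theorem Prog.IsAuxiliary.sem_eq {p : Prog} (hp : p.IsAuxiliary) (s : State) :
    (p.sem s).arr = s.arr ∧ ∀ r, Kept r ∨ r < 4 → (p.sem s).reg r = s.reg r := by
  induction p generalizing s with
  | skip => exact ⟨rfl, fun _ _ => rfl⟩
  | instr I =>
    have h : ∀ x r : ℕ, x = 5 ∨ x = 6 ∨ 20 ≤ x → Kept r ∨ r < 4 → r ≠ x := by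
      rintro x r h1 ((h | h) | h) <;> omega
    cases I with
    | store => exact hp.elim
    | _ => exact ⟨rfl, fun r hr => Function.update_of_ne (h _ r hp hr) _ _⟩
  | seq p q ihp ihq =>
    have h1 := ihp hp.1 s
    have h2 := ihq hp.2 (p.sem s)
    exact ⟨h2.1.trans h1.1, fun r hr => (h2.2 r hr).trans (h1.2 r hr)⟩
  | ite b p q ihp ihq =>
    rw [Prog.sem]
    split_ifs
    · exact ihp hp.1 s
    · exact ihq hp.2 s
  | loop => exact ⟨rfl, fun _ _ => rfl⟩

theorem Prog.IsAuxiliary.isScanBody {n : ℕ} {body : Prog} (hp : body.IsAuxiliary) {s : State}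
    {f : Fin n → ℕ × ℕ → ℕ × ℕ}
    (hf : ∀ s' : State, ∀ z : Fin n, s'.arr = s.arr → (∀ r, Kept r → s'.reg r = s.reg r) →
      s'.reg 4 = z → ((body.sem s').reg 5, (body.sem s').reg 6) = f z (s'.reg 5, s'.reg 6)) :
    IsScanBody body s f := fun s' z ha hk hz =>
  ⟨(hp.sem_eq s').1.trans ha, fun r hr => (hp.sem_eq s').2 r (Or.inr hr),
    fun r hr => ((hp.sem_eq s').2 r (Or.inl hr)).trans (hk r hr), hf s' z ha hk hz⟩

/-- Rounds after the end of the list do nothing, so any bound `k` on the length will do. Registers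
`5` and `6` act as the accumulator of a left fold. -/
theorem sem_repeat {n : ℕ} {body : Prog} {s : State} {f : Fin n → ℕ × ℕ → ℕ × ℕ}
    (hbody : IsScanBody body s f) {a : ℕ} (l : List (Fin n)) (k : ℕ) (s' : State)
    (h0 : ∀ j (hj : j < l.length), s.arr 1 (a + j) = (l[j] : Fin n)) (hk : l.length ≤ k)
    (harr : s'.arr = s.arr) (hkept : ∀ r, Kept r → s'.reg r = s.reg r)
    (h2 : s'.reg 2 = a) (h3 : s'.reg 3 = a + l.length) :
    let s'' := (repeatProg k (.ite (.lt 2 3)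
      (.seq (block [.load 4 1 2]) (.seq body (block [.inc 2]))) .skip)).sem s'
    s''.arr = s.arr ∧ (∀ r, Kept r → s''.reg r = s.reg r) ∧
      (s''.reg 5, s''.reg 6) = l.foldl (fun p z => f z p) (s'.reg 5, s'.reg 6) := by
  induction k generalizing l s' a with
  | zero =>
    obtain rfl : l = [] := List.length_eq_zero_iff.1 (by omega)
    exact ⟨harr, hkept, rfl⟩
  | succ k ih =>
    rw [repeatProg]
    simp only [Prog.sem]
    cases l with
    | nil =>
      rw [if_neg (by simp [Test.Holds, h2, h3])]
      exact ih [] s' h0 (by simp) harr hkept h2 h3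
    | cons z l =>
      rw [if_pos (by simp [Test.Holds, h2, h3])]
      have hz : s.arr 1 a = z := h0 0 (by simp)
      obtain ⟨b1, b2, b3, b4⟩ := hbody ((block [.load 4 1 2]).sem s') z (by simpa [Instr.eval])
        (fun r hr => by
          have : r ≠ 4 := by rcases hr with h | h <;> omega
          simpa [Instr.eval, Function.update_apply, this] using hkept r hr)
        (by simp [Instr.eval, harr, h2, hz])
      generalize hs1 : body.sem ((block [.load 4 1 2]).sem s') = s1 at *
      have i := ih (a := a + 1) l ((block [.inc 2]).sem s1)
        (fun j hj => by
          have := h0 (j + 1) (by simpa using hj)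
          rw [add_assoc, add_comm 1 j]
          simpa using this)
        (by simp at hk; exact hk) (by simpa [Instr.eval] using b1)
        (fun r hr => by
          have : r ≠ 2 := by rcases hr with h | h <;> omega
          simpa [Instr.eval, Function.update_apply, this] using b3 r hr)
        (by simp [Instr.eval, b2 2, h2])
        (by simp [Instr.eval, b2 3, h3]; omega)
      refine ⟨i.1, i.2.1, ?_⟩
      rw [i.2.2, List.foldl_cons]
      congr 1

end RAM

open RAM

/-! ### Reading adjacency lists from memory -/

section Input

variable {n : ℕ} {L : Fin n → List (Fin n)}

theorem listStart_succ (L : Fin n → List (Fin n)) (v : Fin n) :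
    listStart L (v + 1) = listStart L v + (L v).length := by
  have : (L v).length = ∑ u : Fin n, if u = v then (L u).length else 0 := by simp
  rw [this, listStart, listStart, ← Finset.sum_add_distrib]
  refine Finset.sum_congr rfl fun u _ => ?_
  simp only [Fin.ext_iff]
  split_ifs <;> omega

theorem concatLists_getD (L : Fin n → List (Fin n)) (v : Fin n) (j : ℕ) (hj : j < (L v).length) :
    (concatLists L).getD (listStart L v + j) 0 = (L v)[j] := by
  set F : List (List ℕ) := List.ofFn fun v => (L v).map Fin.val with hF
  have h0 : concatLists L = F.flatten := by
    rw [concatLists, hF]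
    congr 2
    funext v
    simp [List.map_eq_flatMap]
  -- Split the concatenation around the list of `v`; the part before it has length `listStart L v`.
  have h1 : concatLists L = (F.take v).flatten ++
      (F[(v : ℕ)]'(by simp [hF]) ++ (F.drop (v + 1)).flatten) := by
    rw [h0, ← List.flatten_cons, List.getElem_cons_drop, ← List.flatten_append,
      List.take_append_drop]
  have h2 : (F.take v).flatten.length = listStart L v := by
    rw [List.length_flatten, List.map_take, hF, List.map_ofFn, List.sum_take_ofFn, listStart,
      Finset.sum_filter]
    simp
  have h3 : F[(v : ℕ)]'(by simp [hF]) = (L v).map Fin.val := by simp [hF]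
  rw [h1, h3, List.getD_append_right _ _ _ _ (by omega), h2, Nat.add_sub_cancel_left,
    List.getD_append _ _ _ _ (by simpa using hj)]
  simp [hj]

/-- The parts of the memory that always keep their contents: the input, and the constants `1` and
`0` in the registers `8` and `9`. -/
structure HasInput (L : Fin n → List (Fin n)) (s : State) : Prop where
  size : s.reg 0 = n
  one : s.reg 8 = 1
  zero : s.reg 9 = 0
  starts : ∀ v : Fin n, s.arr 0 v = listStart L v ∧ s.arr 0 (v + 1) = listStart L (v + 1)
  lists : ∀ i, s.arr 1 i = (concatLists L).getD i 0

theorem HasInput.congr {s s' : State} (h : HasInput L s) (h0 : s'.arr 0 = s.arr 0)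
    (h1 : s'.arr 1 = s.arr 1) (hr : s'.reg 0 = s.reg 0 ∧ s'.reg 8 = s.reg 8 ∧ s'.reg 9 = s.reg 9) :
    HasInput L s' :=
  ⟨hr.1.trans h.size, hr.2.1.trans h.one, hr.2.2.trans h.zero, h0 ▸ h.starts, h1 ▸ h.lists⟩

/-- A whole scan is a fold over an adjacency list, which reduces each phase to a list statement such
as `foldl_find`, `foldl_max` or `foldl_count`. -/
theorem HasInput.scan {s : State} (h : HasInput L s) {v : Fin n} (hv : s.reg 1 = v)
    (hlen : (L v).length ≤ 4) {body : Prog} {f : Fin n → ℕ × ℕ → ℕ × ℕ}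
    (hbody : IsScanBody body s f) :
    ((scan body).sem s).arr = s.arr ∧ (∀ r, Kept r → ((scan body).sem s).reg r = s.reg r) ∧
      (((scan body).sem s).reg 5, ((scan body).sem s).reg 6) =
        (L v).foldl (fun p z => f z p) (s.reg 5, s.reg 6) := by
  have e := sem_repeat hbody (L v) 4
    ((block [.copy 3 1, .inc 3, .load 3 0 3, .load 2 0 1]).sem s) (a := listStart L v)
    (fun j hj => by rw [h.lists, concatLists_getD L v j hj]) hlen (by simp [Instr.eval])
    (fun r hr => by
      have : r ≠ 3 ∧ r ≠ 2 := by rcases hr with h | h <;> omega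
      simp [Instr.eval, this])
    (by simp [Instr.eval, hv, h.starts v])
    (by simp [Instr.eval, hv, h.starts v, listStart_succ])
  simpa [RAM.scan, Prog.sem, Instr.eval] using e

end Input

/-! ### The search phase -/

namespace RAM

/-- Records an unvisited neighbour. -/
def searchTest : Prog :=
  .seq (block [.load 20 3 4]) (.ite (.eq 20 9) (block [.copy 5 4]) .skip)

/-- Finds an unvisited neighbour of the current vertex and goes there, or goes back. -/
def searchBody : Prog :=
  .seq (block [.copy 5 0]) <|
  .seq (scan searchTest) <|
  .ite (.eq 5 0) (block [.load 1 5 1]) <|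
  .seq (block [.inc 7, .store 3 5 7, .store 4 7 5, .store 5 5 1, .load 20 6 1]) <|
  .seq (.ite (.eq 20 9) (block [.store 6 5 8]) .skip) (block [.copy 1 5])

/-- Depth first search from the vertex `0`. Array `3` gets the numbers of the vertices in the order
of discovery, array `4` the inverse of this numbering, array `5` the parents, with `n` for the
root, and array `6` the parities of the depths. -/
def search : Prog :=
  .seq (block [.const 8 1, .const 7 1, .const 1 0, .store 3 1 8, .store 5 1 0])
    (.loop (.ne 1 0) searchBody)

end RAM

section SearchPhase

variable {n : ℕ} {G : SimpleGraph (Fin n)} {L : Fin n → List (Fin n)} {r : Fin n} {k : ℕ}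
  {d : Fin n → ℕ} {pa : Fin n → Fin n} {co : Fin n → Bool} {cur : Option (Fin n)} {s : State}

/-- The arrays written by the search. -/
structure StoresTree (L : Fin n → List (Fin n)) (r : Fin n) (d : Fin n → ℕ) (pa : Fin n → Fin n)
    (co : Fin n → Bool) (s : State) : Prop where
  input : HasInput L s
  num : ∀ v : Fin n, s.arr 3 v = d v
  -- The stored parent of the root is `n`, so looking up the number of the parent gives `0` there,
  -- as `IsCutMarking.cut` demands, without a separate test.
  num_end : s.arr 3 n = 0
  order : ∀ v : Fin n, d v ≠ 0 → s.arr 4 (d v) = v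
  parent : ∀ v : Fin n, s.arr 5 v = if v = r then n else (pa v : ℕ)
  parity : ∀ v : Fin n, s.arr 6 v = (co v).toNat

/-- An ended search is encoded by `n` in register `1`. This is the stored parent of the root, so
going back from the root ends the loop. The arrays known to be zero serve as initial values of the
later phases. -/
structure SearchState (L : Fin n → List (Fin n)) (r : Fin n) (k : ℕ) (d : Fin n → ℕ)
    (pa : Fin n → Fin n) (co : Fin n → Bool) (cur : Option (Fin n)) (s : State) : Prop
    extends StoresTree L r d pa co s where
  count : s.reg 7 = k
  current : s.reg 1 = cur.elim n (fun c => (c : ℕ))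
  rest : ∀ a, a = 2 ∨ 7 ≤ a → ∀ i, s.arr a i = 0

theorem StoresTree.congr {s' : State} (h : StoresTree L r d pa co s)
    (ha : ∀ a, a ≤ 1 ∨ 3 ≤ a ∧ a ≤ 6 → s'.arr a = s.arr a)
    (hr : s'.reg 0 = s.reg 0 ∧ s'.reg 8 = s.reg 8 ∧ s'.reg 9 = s.reg 9) :
    StoresTree L r d pa co s' where
  input := h.input.congr (ha 0 (by simp)) (ha 1 (by simp)) hr
  num := by rw [ha 3 (by simp)]; exact h.num
  num_end := by rw [ha 3 (by simp)]; exact h.num_end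
  order := by rw [ha 4 (by simp)]; exact h.order
  parent := by rw [ha 5 (by simp)]; exact h.parent
  parity := by rw [ha 6 (by simp)]; exact h.parity

theorem foldl_find (d : Fin n → ℕ) (l : List (Fin n)) (p : ℕ × ℕ) :
    let q := l.foldl (fun p z => if d z = 0 then ((z : ℕ), p.2) else p) p
    q = p ∧ (∀ z ∈ l, d z ≠ 0) ∨ ∃ z ∈ l, d z = 0 ∧ q.1 = z := by
  induction l generalizing p with
  | nil => simp
  | cons z l ih =>
    simp only [List.foldl_cons]
    by_cases hz : d z = 0
    · rw [if_pos hz]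
      rcases ih ((z : ℕ), p.2) with ⟨h, -⟩ | ⟨w, h1, h2, h3⟩
      · exact Or.inr ⟨z, by simp, hz, by rw [h]⟩
      · exact Or.inr ⟨w, by simp [h1], h2, h3⟩
    · rw [if_neg hz]
      rcases ih p with ⟨h, h'⟩ | ⟨w, h1, h2, h3⟩
      · exact Or.inl ⟨h, by simpa [hz] using h'⟩
      · exact Or.inr ⟨w, by simp [h1], h2, h3⟩

/-- The two outcomes are those of `IsPartialSearch.retreat` and `IsPartialSearch.visit`. Register
`5` starts the scan with `n`, which is no vertex, so it still holds `n` exactly if no unvisited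
neighbour was found. -/
theorem SearchState.step {c : Fin n} (h : SearchState L r k d pa co (some c) s)
    (hlen : (L c).length ≤ 4) (hco : ∀ v, d v = 0 → co v = false) (hd : ∀ v, d v ≤ k)
    (hr : d r ≠ 0) :
    (∀ z ∈ L c, d z ≠ 0) ∧
      SearchState L r k d pa co (if c = r then none else some (pa c)) (searchBody.sem s) ∨
    ∃ f ∈ L c, d f = 0 ∧ SearchState L r (k + 1) (Function.update d f (k + 1))
      (Function.update pa f c) (Function.update co f (!co c)) (some f) (searchBody.sem s) := by
  have hbody : IsScanBody searchTest ((block [.copy 5 0]).sem s)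
      fun (z : Fin n) p => if d z = 0 then ((z : ℕ), p.2) else p := by
    refine Prog.IsAuxiliary.isScanBody (by simp [searchTest, Prog.IsAuxiliary, block,
      Instr.IsAuxiliary]) fun s' z ha hk hz => ?_
    have h9 : s'.reg 9 = 0 := by
      rw [hk 9 (by simp [Kept])]; simpa [Instr.eval] using h.input.zero
    have hn : s'.arr 3 z = d z := by rw [ha]; simpa [Instr.eval] using h.num z
    by_cases hdz : d z = 0 <;>
      simp [searchTest, Instr.eval, hz, hn, hdz, h9]
  obtain ⟨e1, e2, e3⟩ := HasInput.scan (s := (block [.copy 5 0]).sem s) (v := c) (L := L)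
    (h.input.congr rfl rfl ⟨rfl, rfl, rfl⟩) (by simpa [Instr.eval] using h.current) hlen hbody
  have hfold := foldl_find d (L c) (((block [.copy 5 0]).sem s).reg 5,
    ((block [.copy 5 0]).sem s).reg 6)
  rw [searchBody]
  simp only [sem_seq]
  generalize (scan searchTest).sem ((block [.copy 5 0]).sem s) = t at *
  have r0 : t.reg 0 = n := by rw [e2 0 (by simp [Kept])]; simpa [Instr.eval] using h.input.size
  have r1 : t.reg 1 = c := by rw [e2 1 (by simp [Kept])]; simpa [Instr.eval] using h.current
  have r7 : t.reg 7 = k := by rw [e2 7 (by simp [Kept])]; simpa [Instr.eval] using h.count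
  have r8 : t.reg 8 = 1 := by rw [e2 8 (by simp [Kept])]; simpa [Instr.eval] using h.input.one
  have r9 : t.reg 9 = 0 := by rw [e2 9 (by simp [Kept])]; simpa [Instr.eval] using h.input.zero
  have ea : t.arr = s.arr := e1
  rw [← e3] at hfold
  rcases hfold with ⟨g1, g2⟩ | ⟨f, f1, f2, f3⟩
  · left
    have r5 : t.reg 5 = n := by
      have := (Prod.ext_iff.1 g1).1
      simp only at this
      rw [this]
      simpa [Instr.eval] using h.input.size
    simp only [sem_ite_eq, if_pos (r5.trans r0.symm)]
    refine ⟨g2, h.toStoresTree.congr (fun a _ => by simp [Instr.eval, ea]) ?_, ?_, ?_, ?_⟩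
    · simp [Instr.eval, r0, r8, r9, h.input.size, h.input.one, h.input.zero]
    · simp [Instr.eval, r7]
    · by_cases hcr : c = r <;> simp [Instr.eval, r1, ea, h.parent, hcr]
    · intro a ha i; simpa [Instr.eval, ea] using h.rest a ha i
  · right
    have r5 : t.reg 5 = f := f3
    have hfn : ¬ (f : ℕ) = n := f.2.ne
    have e50 : ¬ t.reg 5 = t.reg 0 := by rwa [r5, r0]
    simp only [sem_ite_eq, if_neg e50]
    refine ⟨f, f1, f2, ?_⟩
    have hpar : s.arr 6 c = (co c).toNat := h.parity c
    have hfr : f ≠ r := by rintro rfl; exact hr f2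
    have key : ∀ s' : State, s'.arr = (fun a => if a = 6 then
          Function.update (s.arr 6) f (!co c).toNat else if a = 5 then
          Function.update (s.arr 5) f c else if a = 4 then
          Function.update (s.arr 4) (k + 1) f else if a = 3 then
          Function.update (s.arr 3) f (k + 1) else s.arr a) →
        s'.reg 0 = n → s'.reg 8 = 1 → s'.reg 9 = 0 → s'.reg 7 = k + 1 → s'.reg 1 = f →
        SearchState L r (k + 1) (Function.update d f (k + 1))
          (Function.update pa f c) (Function.update co f (!co c)) (some f) s' := by
      intro s' a' b0 b8 b9 b7 b1
      have hv : ∀ v : Fin n, (v : ℕ) = f ↔ v = f := fun v => Fin.ext_iff.symm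
      refine ⟨⟨⟨b0, b8, b9, ?_, ?_⟩, ?_, ?_, ?_, ?_, ?_⟩, b7, b1, ?_⟩
      · simpa [a'] using h.input.starts
      · simpa [a'] using h.input.lists
      · intro v; by_cases e : v = f <;> simp [a', hv, e, h.num]
      · simp [a', Ne.symm hfn, h.num_end]
      · intro v hdv
        by_cases e : v = f
        · simp [a', e]
        · simp only [Function.update_of_ne e] at hdv ⊢
          have := hd v
          have h2 : d v ≠ k + 1 := by omega
          simp [a', h2, h.order v hdv]
      · intro v
        by_cases e : v = f
        · simp [a', e, hfr]
        · simp [a', hv, e, h.parent]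
      · intro v; by_cases e : v = f <;> simp [a', hv, e, h.parity]
      · intro a ha i
        have h1 : a ≠ 6 ∧ a ≠ 5 ∧ a ≠ 4 ∧ a ≠ 3 := by omega
        simp [a', h1, h.rest a ha i]
    -- The program stores only parity `1`. Parity `0` is already in memory, so the omitted store
    -- counts as a trivial update.
    have h6 : s.arr 6 f = 0 := by rw [h.parity, hco f f2]; rfl
    have h6' : Function.update (s.arr 6) f 0 = s.arr 6 := by
      rw [← h6, Function.update_eq_self]
    have hcc : co c = false ∨ co c = true := by cases co c <;> simp
    rcases hcc with hcc | hcc <;>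
    · rw [hcc] at hpar
      refine key _ ?_ ?_ ?_ ?_ ?_ ?_
      · funext a
        by_cases a6 : a = 6
        · subst a6; simp [Instr.eval, ea, r1, r5, r7, r8, r9, hpar, hcc, h6']
        by_cases a5 : a = 5
        · subst a5; simp [Instr.eval, ea, r1, r5, r7, r8, r9, hpar]
        by_cases a4 : a = 4
        · subst a4; simp [Instr.eval, ea, r1, r5, r7, r8, r9, hpar]
        by_cases a3 : a = 3
        · subst a3; simp [Instr.eval, ea, r1, r5, r7, r8, r9, hpar]
        simp [Instr.eval, ea, r1, r5, r7, r8, r9, hpar, a6, a5, a4, a3]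
      all_goals simp [Instr.eval, ea, r1, r5, r7, r8, r9, r0, hpar]

theorem searchBody_loopFree : searchBody.LoopFree := by
  simp only [searchBody, searchTest, Prog.LoopFree, block_loopFree, and_true, true_and]
  exact scan_loopFree (by simp [Prog.LoopFree, block_loopFree])

theorem exec_search (hL : IsAdjacencyLists G L) (hlen : ∀ v, (L v).length ≤ 4) (hr : (r : ℕ) = 0)
    (hG : G.Preconnected) :
    ∃ s t d pa co, Exec search (inputState L) s t ∧ t ≤ 6 + ((searchBody.cost + 1) * (2 * n) + 1) ∧
      IsSearchTree G r d pa co ∧ StoresTree L r d pa co s ∧ (∀ v, d v ≤ n) ∧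
      (∀ i, 0 < i → i ≤ n → ∃ v, d v = i) ∧ ∀ a, a = 2 ∨ 7 ≤ a → ∀ i, s.arr a i = 0 := by
  have hn : 0 < n := by have := r.2; omega
  set B := block [.const 8 1, .const 7 1, .const 1 0, .store 3 1 8, .store 5 1 0]
  obtain ⟨t₀, ht₀, ht₀'⟩ := (block_loopFree [.const 8 1, .const 7 1, .const 1 0, .store 3 1 8,
    .store 5 1 0]).exec (inputState L)
  have hinit : SearchState L r 1 (Function.update 0 r 1) (fun _ => r) (fun _ => false) (some r)
      (B.sem (inputState L)) := by
    have hv : ∀ v : Fin n, (v : ℕ) = 0 ↔ v = r := fun v => by rw [Fin.ext_iff, hr]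
    refine ⟨⟨⟨?_, ?_, ?_, fun v => ⟨?_, ?_⟩, ?_⟩, ?_, ?_, ?_, ?_, ?_⟩, ?_, ?_, ?_⟩
    · simp [B, Instr.eval, inputState]
    · simp [B, Instr.eval]
    · simp [B, Instr.eval, inputState]
    · simp [B, Instr.eval, inputState]
    · simp [B, Instr.eval, inputState]
    · simp [B, Instr.eval, inputState]
    · intro v
      by_cases e : v = r <;> simp [B, Instr.eval, inputState, e, hr, hv]
    · simp [B, Instr.eval, inputState, hn.ne']
    · intro v hdv
      have e : v = r := by by_contra e; simp [e] at hdv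
      simp [B, Instr.eval, inputState, e, hr]
    · intro v
      by_cases e : v = r
      · simp [B, Instr.eval, inputState, e, hr]
      · simp [B, Instr.eval, inputState, e, hr, hv]
    · intro v; simp [B, Instr.eval, inputState]
    · simp [B, Instr.eval]
    · simp [B, Instr.eval, hr]
    · intro a ha i
      have h1 : a ≠ 3 ∧ a ≠ 5 ∧ a ≠ 0 ∧ a ≠ 1 := by omega
      simp [B, Instr.eval, inputState, h1]
  -- Each round visits or retires one vertex. The sum of the two counts is at most `2n` and starts
  -- at `1`, leaving at most `2n - 1` rounds.
  obtain ⟨s, t, hs, ht, hend, m, k, d, pa, co, R, cur, hS, hM, -⟩ := exec_loop searchBody_loopFree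
    (b := .ne 1 0) (fun m s => ∃ k d pa co R cur, IsPartialSearch G r k d pa co R cur ∧
      SearchState L r k d pa co cur s ∧ m + k + R.card = 2 * n)
    (by
      rintro m s ⟨k, d, pa, co, R, cur, hS, hM, hm⟩ hb
      cases cur with
      | none => exact absurd (hM.current.trans hM.input.size.symm) hb
      | some c =>
        rcases hM.step (hlen c) hS.fresh hS.le (by rw [hS.root]; omega) with
          ⟨h1, h2⟩ | ⟨f, h1, h2, h3⟩
        · obtain ⟨g1, g2⟩ := hS.retreat fun w hw => h1 w (((hL c).2 w).2 hw)
          have := g2.card_add_card_le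
          rw [Finset.card_insert_of_notMem g1, Fintype.card_fin] at this
          refine ⟨m - 1, by omega, k, d, pa, co, _, _, g2, h2, ?_⟩
          rw [Finset.card_insert_of_notMem g1]
          omega
        · have g := hS.visit (((hL c).2 f).1 h1) h2
          have := g.card_add_card_le
          rw [Fintype.card_fin] at this
          exact ⟨m - 1, by omega, _, _, _, _, _, _, g, h3, by omega⟩)
    (2 * n - 1) (B.sem (inputState L)) ⟨1, _, _, _, ∅, _, .start G r, hinit, by simp; omega⟩
  have hcur : cur = none := by
    cases cur with
    | none => rfl
    | some c =>
      refine absurd (fun e => c.2.ne ?_) hend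
      rw [hM.input.size, hM.current] at e
      exact e
  subst hcur
  obtain ⟨T, h1, h2⟩ := hS.isSearchTree hG
  rw [Fintype.card_fin] at h1 h2
  refine ⟨s, t₀ + t, d, pa, co, .seq ht₀ hs, ?_, T, hM.toStoresTree, h1, h2, hM.rest⟩
  have : (searchBody.cost + 1) * (2 * n - 1) ≤ (searchBody.cost + 1) * (2 * n) :=
    Nat.mul_le_mul_left _ (by omega)
  simp only [block, Prog.cost] at ht₀'
  omega

end SearchPhase

/-! ### The marking phase -/

namespace RAM

/-- Records the number of a neighbour to which an edge leads that closes an odd cycle. -/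
def markTest : Prog :=
  .seq (block [.load 20 3 4, .load 21 6 4]) <|
  .ite (.lt 20 11) (.ite (.eq 21 12) (.ite (.lt 5 20) (block [.copy 5 20]) .skip) .skip) .skip

/-- Decides whether the edge from a vertex to its parent is cut. -/
def markBody : Prog :=
  .seq (block [.load 1 4 10, .load 5 7 1, .load 11 3 1, .load 12 6 1]) <|
  .seq (scan markTest) <|
  .seq (block [.store 7 1 5, .load 20 5 1, .load 21 3 20]) <|
  .seq (.ite (.eq 5 21) (block [.store 8 1 8])
    (.seq (block [.load 22 7 20]) (.ite (.lt 22 5) (block [.store 7 20 5]) .skip)))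
  (block [.dec 10])

/-- Decides bottom-up which edges of the tree are cut, and marks their lower ends in array `8`. -/
def mark : Prog := .seq (block [.copy 10 0]) (.loop (.lt 9 10) markBody)

theorem markBody_loopFree : markBody.LoopFree := by
  simp only [markBody, markTest, Prog.LoopFree, block_loopFree, and_true, true_and]
  exact scan_loopFree (by simp [Prog.LoopFree, block_loopFree])

end RAM

section MarkPhase

variable {n : ℕ} {G : SimpleGraph (Fin n)} {L : Fin n → List (Fin n)} {r : Fin n} {i : ℕ}
  {d H : Fin n → ℕ} {pa : Fin n → Fin n} {co C : Fin n → Bool} {s : State}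

structure StoresMarks (L : Fin n → List (Fin n)) (r : Fin n) (d : Fin n → ℕ) (pa : Fin n → Fin n)
    (co : Fin n → Bool) (H : Fin n → ℕ) (C : Fin n → Bool) (s : State) : Prop
    extends StoresTree L r d pa co s where
  low : ∀ v : Fin n, s.arr 7 v = H v
  cut : ∀ v : Fin n, s.arr 8 v = (C v).toNat
  rest : ∀ a, a = 2 ∨ 9 ≤ a → ∀ i, s.arr a i = 0

theorem foldl_max (d : Fin n → ℕ) (P : Fin n → Prop) [DecidablePred P] (l : List (Fin n))
    (p : ℕ × ℕ) :
    let q := l.foldl (fun p z => if P z then (max p.1 (d z), p.2) else p) p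
    p.1 ≤ q.1 ∧ (∀ z ∈ l, P z → d z ≤ q.1) ∧ (q.1 = p.1 ∨ ∃ z ∈ l, P z ∧ q.1 = d z) := by
  induction l generalizing p with
  | nil => simp
  | cons z l ih =>
    simp only [List.foldl_cons]
    by_cases hz : P z
    · rw [if_pos hz]
      obtain ⟨h1, h2, h3⟩ := ih (max p.1 (d z), p.2)
      simp only at h1 h3
      refine ⟨(le_max_left _ _).trans h1, ?_, ?_⟩
      · rintro w hw hP
        rcases List.mem_cons.1 hw with rfl | hw
        · exact (le_max_right _ _).trans h1
        · exact h2 w hw hP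
      · rcases h3 with h3 | ⟨w, hw, hP, h⟩
        · rcases le_total p.1 (d z) with hle | hle
          · exact Or.inr ⟨z, by simp, hz, by rw [h3, max_eq_right hle]⟩
          · exact Or.inl (by rw [h3, max_eq_left hle])
        · exact Or.inr ⟨w, by simp [hw], hP, h⟩
    · rw [if_neg hz]
      obtain ⟨h1, h2, h3⟩ := ih p
      refine ⟨h1, ?_, ?_⟩
      · rintro w hw hP
        rcases List.mem_cons.1 hw with rfl | hw
        · exact absurd hP hz
        · exact h2 w hw hP
      · rcases h3 with h3 | ⟨w, hw, hP, h⟩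
        · exact Or.inl h3
        · exact Or.inr ⟨w, by simp [hw], hP, h⟩

theorem toNat_eq_toNat {a b : Bool} : a.toNat = b.toNat ↔ a = b := by
  cases a <;> cases b <;> simp

/-- One round carries out the update of `IsCutMarking.succ`; the cases below are the three branches
of that statement. -/
theorem StoresMarks.step (hL : IsAdjacencyLists G L) (hlen : ∀ v, (L v).length ≤ 4)
    (T : IsSearchTree G r d pa co) (hC : IsCutMarking G r d pa co (i + 1) H C)
    (h : StoresMarks L r d pa co H C s) (hi : s.reg 10 = i + 1) {y : Fin n} (hy : d y = i + 1) :
    ∃ H' C', IsCutMarking G r d pa co i H' C' ∧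
      StoresMarks L r d pa co H' C' (markBody.sem s) ∧ (markBody.sem s).reg 10 = i := by
  set B := block [.load 1 4 10, .load 5 7 1, .load 11 3 1, .load 12 6 1] with hB
  have h4 : s.arr 4 (i + 1) = y := by rw [← hy]; exact h.order y (by omega)
  have b1 : (B.sem s).reg 1 = y := by simp [hB, Instr.eval, hi, h4]
  have b5 : (B.sem s).reg 5 = H y := by simp [hB, Instr.eval, hi, h4, h.low]
  have b11 : (B.sem s).reg 11 = d y := by simp [hB, Instr.eval, hi, h4, h.num]
  have b12 : (B.sem s).reg 12 = (co y).toNat := by simp [hB, Instr.eval, hi, h4, h.parity]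
  have bin : HasInput L (B.sem s) := h.input.congr rfl rfl (by simp [hB, Instr.eval])
  have b10 : (B.sem s).reg 10 = i + 1 := by simpa [hB, Instr.eval] using hi
  have ba : (B.sem s).arr = s.arr := rfl
  have hbody : IsScanBody markTest (B.sem s)
      fun (z : Fin n) p => if d z < d y ∧ co z = co y then (max p.1 (d z), p.2) else p := by
    refine Prog.IsAuxiliary.isScanBody (by simp [markTest, Prog.IsAuxiliary, block,
      Instr.IsAuxiliary]) fun s' z ha hk hz => ?_
    have k11 : s'.reg 11 = d y := by rw [hk 11 (by simp [Kept]), b11]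
    have k12 : s'.reg 12 = (co y).toNat := by rw [hk 12 (by simp [Kept]), b12]
    have hn : s'.arr 3 z = d z := by rw [ha, ba, h.num]
    have hc : s'.arr 6 z = (co z).toNat := by rw [ha, ba, h.parity]
    by_cases h1 : d z < d y <;> by_cases h2 : co z = co y <;> by_cases h3 : s'.reg 5 < d z <;>
      simp [markTest, Instr.eval, hz, hn, hc, k11, k12, h1, h2, h3, toNat_eq_toNat] <;> omega
  obtain ⟨e1, e2, e3⟩ := bin.scan b1 (hlen y) hbody
  obtain ⟨m1, m2, m3⟩ := foldl_max d (fun z => d z < d y ∧ co z = co y) (L y)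
    ((B.sem s).reg 5, (B.sem s).reg 6)
  rw [markBody]
  simp only [sem_seq, ← hB]
  generalize (scan markTest).sem (B.sem s) = t at *
  rw [← e3] at m1 m2 m3
  simp only [b5] at m1 m2 m3
  have ea : t.arr = s.arr := e1.trans ba
  have r0 : t.reg 0 = n := by rw [e2 0 (by simp [Kept])]; exact bin.size
  have r1 : t.reg 1 = y := by rw [e2 1 (by simp [Kept])]; exact b1
  have r8 : t.reg 8 = 1 := by rw [e2 8 (by simp [Kept])]; exact bin.one
  have r9 : t.reg 9 = 0 := by rw [e2 9 (by simp [Kept])]; exact bin.zero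
  have r10 : t.reg 10 = i + 1 := by rw [e2 10 (by simp [Kept])]; exact b10
  have conf : ∀ a, Conflict G d co y a ↔ a ∈ L y ∧ d a < d y ∧ co a = co y := fun a => by
    rw [Conflict, (hL y).2]
  have hsucc := hC.succ T hy m1 (fun a ha => m2 a ((conf a).1 ha).1 ((conf a).1 ha).2)
    (m3.imp_right fun ⟨a, h1, h2, h3⟩ => ⟨a, (conf a).2 ⟨h1, h2⟩, h3⟩)
  generalize hh : t.reg 5 = x at *
  have hv : ∀ v w : Fin n, (v : ℕ) = w ↔ v = w := fun v w => Fin.ext_iff.symm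
  have hvn : ∀ v : Fin n, (v : ℕ) ≠ n := fun v => v.2.ne
  have key : ∀ s' : State, ∀ H' C', (∀ a, a ≠ 7 → a ≠ 8 → s'.arr a = s.arr a) →
      (∀ v : Fin n, s'.arr 7 v = H' v) → (∀ v : Fin n, s'.arr 8 v = (C' v).toNat) →
      s'.reg 0 = n → s'.reg 8 = 1 → s'.reg 9 = 0 → StoresMarks L r d pa co H' C' s' := by
    intro s' H' C' ha h7 h8 q0 q8 q9
    refine ⟨h.toStoresTree.congr (fun a ha' => ha a (by omega) (by omega))
      ⟨q0.trans h.input.size.symm, q8.trans h.input.one.symm, q9.trans h.input.zero.symm⟩,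
      h7, h8, fun a ha' j => ?_⟩
    rw [ha a (by omega) (by omega)]
    exact h.rest a ha' j
  have hp : s.arr 5 y = if y = r then n else (pa y : ℕ) := h.parent y
  have hq : s.arr 3 (s.arr 5 y) = if y = r then 0 else d (pa y) := by
    rw [hp]; split_ifs
    · exact h.num_end
    · exact h.num _
  by_cases hx : x = if y = r then 0 else d (pa y)
  · rw [if_pos hx] at hsucc
    rw [← hx] at hq
    refine ⟨_, _, hsucc, key _ _ _ ?_ ?_ ?_ ?_ ?_ ?_, ?_⟩
    · intro a h7 h8; simp [Instr.eval, ea, r1, hq, hh, h7, h8]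
    · intro v; by_cases e : v = y <;> simp [Instr.eval, ea, r1, hq, hh, hv, e, h.low]
    · intro v; by_cases e : v = y <;> simp [Instr.eval, ea, r1, r8, hq, hh, hv, e, h.cut]
    all_goals simp [Instr.eval, ea, r1, r0, r8, r9, r10, hq, hh]
  rw [if_neg hx] at hsucc
  by_cases hyr : y = r
  · rw [if_pos hyr] at hsucc hq hp hx
    rw [hp] at hq
    -- The root's stored parent is `n`, so the comparison and the possible store concern an index of
    -- array `7` that belongs to no vertex.
    by_cases hlt : s.arr 7 n < x
    all_goals
      refine ⟨_, _, hsucc, key _ _ _ ?_ ?_ ?_ ?_ ?_ ?_, ?_⟩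
      · intro a h7 h8; simp [Instr.eval, ea, r1, hq, hh, hx, hp, h7, hlt, (hvn _).symm]
      · intro v
        by_cases e : v = y <;>
          simp [Instr.eval, ea, r1, hq, hh, hv, e, h.low, hp, hx, hlt, hvn, (hvn _).symm]
      · intro v; simp [Instr.eval, ea, r1, hq, hh, h.cut, hp, hx, hlt, (hvn _).symm]
      all_goals simp [Instr.eval, ea, r1, r0, r8, r9, r10, hq, hh, hp, hx, hlt, (hvn _).symm]
  · rw [if_neg hyr] at hsucc hq hp hx
    rw [hp] at hq
    have hpy : pa y ≠ y := fun e => (T.lt y hyr).ne (by rw [e])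
    by_cases hlt : H (pa y) < x
    · rw [max_eq_right hlt.le] at hsucc
      refine ⟨_, _, hsucc, key _ _ _ ?_ ?_ ?_ ?_ ?_ ?_, ?_⟩
      · intro a h7 h8; simp [Instr.eval, ea, r1, hq, hh, hx, hp, h7, hlt, hv, hpy, h.low]
      · intro v
        by_cases e' : v = pa y
        · simp [Instr.eval, ea, r1, hq, hh, hx, hp, hlt, hv, hpy, h.low, e']
        by_cases e : v = y <;>
          simp [Instr.eval, ea, r1, hq, hh, hx, hp, hlt, hv, hpy, h.low, e', e, hpy.symm]
      · intro v; simp [Instr.eval, ea, r1, hq, hh, h.cut, hp, hx, hlt, hv, hpy, h.low]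
      all_goals simp [Instr.eval, ea, r1, r0, r8, r9, r10, hq, hh, hp, hx, hlt, hv, hpy, h.low]
    · have hself : Function.update (Function.update H y x) (pa y) (H (pa y)) =
          Function.update H y x := by
        rw [← Function.update_of_ne hpy x H, Function.update_eq_self]
      rw [max_eq_left (not_lt.1 hlt), hself] at hsucc
      refine ⟨_, _, hsucc, key _ _ _ ?_ ?_ ?_ ?_ ?_ ?_, ?_⟩
      · intro a h7 h8; simp [Instr.eval, ea, r1, hq, hh, hx, hp, h7, hlt, hv, hpy, h.low]
      · intro v
        by_cases e : v = y <;> simp [Instr.eval, ea, r1, hq, hh, hx, hp, hlt, hv, hpy, h.low, e]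
      · intro v; simp [Instr.eval, ea, r1, hq, hh, h.cut, hp, hx, hlt, hv, hpy, h.low]
      all_goals simp [Instr.eval, ea, r1, r0, r8, r9, r10, hq, hh, hp, hx, hlt, hv, hpy, h.low]

theorem exec_mark (hL : IsAdjacencyLists G L) (hlen : ∀ v, (L v).length ≤ 4)
    (T : IsSearchTree G r d pa co) (hle : ∀ v, d v ≤ n) (hsurj : ∀ i, 0 < i → i ≤ n → ∃ v, d v = i)
    (h : StoresTree L r d pa co s) (hs : ∀ a, a = 2 ∨ 7 ≤ a → ∀ i, s.arr a i = 0) :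
    ∃ s' t H C, Exec mark s s' t ∧ t ≤ 2 + ((markBody.cost + 1) * n + 1) ∧
      IsCutMarking G r d pa co 0 H C ∧ StoresMarks L r d pa co H C s' := by
  obtain ⟨t₀, ht₀, ht₀'⟩ := (block_loopFree [.copy 10 0]).exec s
  obtain ⟨s', t, he, ht, hend, m, hm, -, H, C, hC, hS⟩ := exec_loop markBody_loopFree
    (b := .lt 9 10) (fun m s => s.reg 10 = m ∧ m ≤ n ∧ ∃ H C, IsCutMarking G r d pa co m H C ∧
      StoresMarks L r d pa co H C s)
    (by
      rintro m s ⟨hm, hmn, H, C, hC, hS⟩ hb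
      have hb' : 0 < m := by rw [← hm, ← hS.input.zero]; exact hb
      obtain ⟨i, rfl⟩ : ∃ i, m = i + 1 := ⟨m - 1, by omega⟩
      obtain ⟨y, hy⟩ := hsurj _ hb' hmn
      obtain ⟨H', C', h1, h2, h3⟩ := hS.step hL hlen T hC hm hy
      exact ⟨i, by omega, h3, by omega, H', C', h1, h2⟩)
    n ((block [.copy 10 0]).sem s)
    ⟨by simp [Instr.eval, h.input.size], le_rfl, fun _ => 0, fun _ => false,
      ⟨fun y hy => absurd (hle y) (by omega), by simp, by simp,
        fun y hy => absurd (hle y) (by omega), by simp⟩,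
      h.congr (fun _ _ => rfl) (by simp [Instr.eval]), fun v => hs 7 (by simp) _,
      fun v => hs 8 (by simp) _, fun a ha => hs a (by omega)⟩
  have h0 : m = 0 := by
    by_contra h0
    refine hend (?_ : s'.reg 9 < s'.reg 10)
    rw [hS.input.zero, hm]; omega
  subst h0
  refine ⟨s', t₀ + t, H, C, .seq ht₀ he, ?_, hC, hS⟩
  simp only [block, Prog.cost] at ht₀'
  omega

end MarkPhase

/-! ### Labelling and balancing phases -/

namespace RAM

/-- Copies the label of the parent, unless the edge to the parent is cut. -/
def labelBody : Prog :=
  .seq (block [.inc 10, .load 1 4 10, .load 20 8 1])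
    (.ite (.eq 20 8) (block [.store 9 1 1]) (block [.load 21 5 1, .load 22 9 21, .store 9 1 22]))

/-- Stores in array `9` the topmost vertex of the piece of each vertex. -/
def label : Prog := .seq (block [.const 10 0]) (.loop (.lt 10 0) labelBody)

theorem labelBody_loopFree : labelBody.LoopFree := by
  simp only [labelBody, Prog.LoopFree, block_loopFree, and_true]

/-- Counts an edge to a piece treated before. -/
def balanceTest : Prog :=
  .seq (block [.load 20 3 4, .load 21 9 4]) <|
  .ite (.lt 11 20)
    (.ite (.ne 21 13)
      (.seq (block [.load 22 12 21, .load 23 6 4]) <|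
        .ite (.eq 23 12)
          (.ite (.eq 22 9) (block [.inc 6]) (block [.inc 5]))
          (.ite (.eq 22 9) (block [.inc 5]) (block [.inc 6])))
      .skip)
    .skip

/-- Counts the edges from a vertex to the pieces treated before, and decides whether to turn the
piece if it is complete. -/
def balanceBody : Prog :=
  .seq (block [.load 1 4 10, .load 11 3 1, .load 12 6 1, .load 13 9 1, .load 5 10 13,
    .load 6 11 13]) <|
  .seq (scan balanceTest) <|
  .seq (block [.store 10 13 5, .store 11 13 6, .load 20 8 1]) <|
  .seq (.ite (.eq 20 8) (.ite (.lt 5 6) (block [.store 12 1 8]) .skip) .skip)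
  (block [.dec 10])

/-- Marks in array `12`, at their topmost vertices, the pieces to be turned. -/
def balance : Prog := .seq (block [.copy 10 0]) (.loop (.lt 9 10) balanceBody)

theorem balanceBody_loopFree : balanceBody.LoopFree := by
  simp only [balanceBody, balanceTest, Prog.LoopFree, block_loopFree, and_true, true_and]
  exact scan_loopFree (by simp [Prog.LoopFree, block_loopFree])

end RAM

section LabelPhase

variable {n : ℕ} {G : SimpleGraph (Fin n)} {L : Fin n → List (Fin n)} {r : Fin n} {i : ℕ}
  {d : Fin n → ℕ} {pa lab : Fin n → Fin n} {co C : Fin n → Bool} {s : State}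

structure StoresLabels (L : Fin n → List (Fin n)) (r : Fin n) (d : Fin n → ℕ) (pa : Fin n → Fin n)
    (co : Fin n → Bool) (C : Fin n → Bool) (lab : Fin n → Fin n) (s : State) : Prop
    extends StoresTree L r d pa co s where
  cut : ∀ v : Fin n, s.arr 8 v = (C v).toNat
  label : ∀ v : Fin n, s.arr 9 v = lab v

theorem StoresLabels.congr {s' : State} (h : StoresLabels L r d pa co C lab s)
    (ha : ∀ a, a ≠ 2 → a ≤ 9 → s'.arr a = s.arr a)
    (hr : s'.reg 0 = s.reg 0 ∧ s'.reg 8 = s.reg 8 ∧ s'.reg 9 = s.reg 9) :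
    StoresLabels L r d pa co C lab s' where
  toStoresTree := h.toStoresTree.congr (fun a _ => ha a (by omega) (by omega)) hr
  cut := by rw [ha 8 (by simp) (by simp)]; exact h.cut
  label := by rw [ha 9 (by simp) (by simp)]; exact h.label

theorem StoresLabels.step (T : IsSearchTree G r d pa co) (hr : C r = true)
    (h : StoresLabels L r d pa co C lab s) (hi : s.reg 10 = i)
    (hrest : ∀ a, a = 2 ∨ 10 ≤ a → ∀ j, s.arr a j = 0) {y : Fin n} (hy : d y = i + 1) :
    StoresLabels L r d pa co C (Function.update lab y (if C y = true then y else lab (pa y)))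
      (labelBody.sem s) ∧ (labelBody.sem s).reg 10 = i + 1 ∧
      ∀ a, a = 2 ∨ 10 ≤ a → ∀ j, (labelBody.sem s).arr a j = 0 := by
  have h4 : s.arr 4 (i + 1) = y := by rw [← hy]; exact h.order y (by omega)
  have hv : ∀ v w : Fin n, (v : ℕ) = w ↔ v = w := fun v w => Fin.ext_iff.symm
  have h8 : s.reg 8 = 1 := h.input.one
  have hc := h.cut y
  have key : ∀ s' : State, (∀ a, a ≠ 9 → s'.arr a = s.arr a) →
      (∀ v : Fin n, s'.arr 9 v =
        (Function.update lab y (if C y = true then y else lab (pa y)) v : Fin n)) →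
      s'.reg 0 = s.reg 0 → s'.reg 8 = s.reg 8 → s'.reg 9 = s.reg 9 → s'.reg 10 = i + 1 →
      StoresLabels L r d pa co C (Function.update lab y (if C y = true then y else lab (pa y))) s' ∧
        s'.reg 10 = i + 1 ∧ ∀ a, a = 2 ∨ 10 ≤ a → ∀ j, s'.arr a j = 0 := by
    intro s' ha h9 q0 q8 q9 q10
    refine ⟨⟨h.toStoresTree.congr (fun a _ => ha a (by omega)) ⟨q0, q8, q9⟩, ?_, h9⟩, q10, ?_⟩
    · rw [ha 8 (by simp)]; exact h.cut
    · intro a ha' j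
      rw [ha a (by omega)]
      exact hrest a ha' j
  have hcc : C y = false ∨ C y = true := by cases C y <;> simp
  rcases hcc with hcc | hcc
  · have hyr : y ≠ r := by rintro rfl; rw [hr] at hcc; cases hcc
    have hp : s.arr 5 y = pa y := by rw [h.parent, if_neg hyr]
    refine key _ ?_ ?_ ?_ ?_ ?_ ?_
    · intro a ha; simp [labelBody, Instr.eval, hi, h4, hc, hcc, h8, ha]
    · intro v
      by_cases e : v = y <;>
        simp [labelBody, Instr.eval, hi, h4, hc, hcc, h8, hp, hv, e, h.label]
    all_goals simp [labelBody, Instr.eval, hi, h4, hc, hcc, h8]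
  · refine key _ ?_ ?_ ?_ ?_ ?_ ?_
    · intro a ha; simp [labelBody, Instr.eval, hi, h4, hc, hcc, h8, ha]
    · intro v
      by_cases e : v = y <;>
        simp [labelBody, Instr.eval, hi, h4, hc, hcc, h8, hv, e, h.label]
    all_goals simp [labelBody, Instr.eval, hi, h4, hc, hcc, h8]

theorem exec_label {H : Fin n → ℕ} (T : IsSearchTree G r d pa co) (hr : C r = true)
    (hr0 : (r : ℕ) = 0) (hle : ∀ v, d v ≤ n) (hsurj : ∀ i, 0 < i → i ≤ n → ∃ v, d v = i)
    (h : StoresMarks L r d pa co H C s) :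
    ∃ s' t lab, Exec label s s' t ∧ t ≤ 2 + ((labelBody.cost + 1) * n + 1) ∧
      IsLabelling pa C lab ∧ StoresLabels L r d pa co C lab s' ∧
      ∀ a, a = 2 ∨ 10 ≤ a → ∀ j, s'.arr a j = 0 := by
  obtain ⟨t₀, ht₀, ht₀'⟩ := (block_loopFree [.const 10 0]).exec s
  -- The pass runs top-down: a parent has a smaller number than its child, so its label is already
  -- final when it is copied.
  obtain ⟨s', t, he, ht, hend, m, hm, hmn, lab, hlr, hlab, hS, hrest⟩ :=
    exec_loop labelBody_loopFree (b := .lt 10 0)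
    (fun m s => s.reg 10 = n - m ∧ m ≤ n ∧ ∃ lab : Fin n → Fin n, lab r = r ∧
      (∀ v, d v ≤ n - m → (C v = true → lab v = v) ∧ (C v = false → lab v = lab (pa v))) ∧
      StoresLabels L r d pa co C lab s ∧ ∀ a, a = 2 ∨ 10 ≤ a → ∀ j, s.arr a j = 0)
    (by
      rintro m s ⟨hm, hmn, lab, hlr, hlab, hS, hrest⟩ hb
      have hb' : n - m < n := by rw [← hm, ← hS.input.size]; exact hb
      obtain ⟨y, hy⟩ := hsurj (n - m + 1) (by omega) (by omega)
      obtain ⟨h1, h2, h3⟩ := hS.step T hr hm hrest hy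
      have em : n - (m - 1) = n - m + 1 := by omega
      refine ⟨m - 1, by omega, by rw [h2, em], by omega, _, ?_, fun v hv => ?_, h1, h3⟩
      · by_cases e : r = y
        · rw [← e, Function.update_self, if_pos hr]
        · rw [Function.update_of_ne e, hlr]
      · rw [em] at hv
        by_cases e : v = y
        · subst e
          rw [Function.update_self]
          refine ⟨fun hc => if_pos hc, fun hc => ?_⟩
          have hvr : v ≠ r := by rintro rfl; rw [hr] at hc; cases hc
          have : pa v ≠ v := fun e => (T.lt v hvr).ne (by rw [e])
          rw [if_neg (by simp [hc]), Function.update_of_ne this]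
        · have hv' : d v ≤ n - m := by
            have : d v ≠ d y := fun e' => e (T.inj e')
            omega
          rw [Function.update_of_ne e]
          refine ⟨(hlab v hv').1, fun hc => ?_⟩
          have hvr : v ≠ r := by rintro rfl; rw [hr] at hc; cases hc
          have : pa v ≠ y := by
            rintro rfl
            have := T.lt v hvr
            omega
          rw [Function.update_of_ne this]
          exact (hlab v hv').2 hc)
    n ((block [.const 10 0]).sem s)
    -- The zeros in array `9` read as the constant labelling by the root, which is the vertex `0`.
    ⟨by simp [Instr.eval], le_rfl, fun _ => r, rfl,
      fun v hv => by have := T.pos v; omega,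
      ⟨h.toStoresTree.congr (fun _ _ => rfl) (by simp [Instr.eval]), h.cut,
        fun v => by simpa [Instr.eval, hr0] using h.rest 9 (by simp) v⟩,
      fun a ha => h.rest a (by omega)⟩
  have h0 : m = 0 := by
    by_contra h0
    refine hend (?_ : s'.reg 10 < s'.reg 0)
    rw [hS.input.size, hm]; omega
  subst h0
  refine ⟨s', t₀ + t, lab, .seq ht₀ he, ?_, fun v => hlab v (hle v), hS, hrest⟩
  simp only [block, Prog.cost] at ht₀'
  omega

end LabelPhase

section BalancePhase

variable {n : ℕ} {G : SimpleGraph (Fin n)} [DecidableRel G.Adj] {L : Fin n → List (Fin n)}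
  {r : Fin n} {i : ℕ} {d good bad : Fin n → ℕ} {pa lab : Fin n → Fin n} {co C t : Fin n → Bool}
  {s : State}

/-- The lists have no repetitions, so counting entries is counting neighbours. -/
theorem foldl_count (hL : IsAdjacencyLists G L) (v : Fin n) (P : Fin n → Prop) [DecidablePred P]
    (Q : Fin n → Bool) (p : ℕ × ℕ) :
    (L v).foldl (fun p z => if P z then if Q z = true then (p.1 + 1, p.2) else (p.1, p.2 + 1)
      else p) p =
    (p.1 + (Finset.univ.filter fun z => G.Adj v z ∧ P z ∧ Q z = true).card,
      p.2 + (Finset.univ.filter fun z => G.Adj v z ∧ P z ∧ Q z = false).card) := by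
  have hcard : ∀ R : Fin n → Prop, ∀ [DecidablePred R],
      (Finset.univ.filter fun z => G.Adj v z ∧ R z).card = (L v).countP fun z => R z := by
    intro R _
    rw [List.countP_eq_length_filter, ← List.toFinset_card_of_nodup ((hL v).1.filter _)]
    congr 1
    ext z
    simp [(hL v).2]
  rw [hcard, hcard]
  generalize L v = l
  induction l generalizing p with
  | nil => simp
  | cons z l ih =>
    simp only [List.foldl_cons, ih, List.countP_cons]
    by_cases h1 : P z <;> cases h2 : Q z <;> simp [h1] <;> omega

structure StoresTurns (L : Fin n → List (Fin n)) (r : Fin n) (d : Fin n → ℕ) (pa : Fin n → Fin n)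
    (co : Fin n → Bool) (C : Fin n → Bool) (lab : Fin n → Fin n) (good bad : Fin n → ℕ)
    (t : Fin n → Bool) (s : State) : Prop extends StoresLabels L r d pa co C lab s where
  good : ∀ v : Fin n, s.arr 10 v = good v
  bad : ∀ v : Fin n, s.arr 11 v = bad v
  turn : ∀ v : Fin n, s.arr 12 v = (t v).toNat
  rest : ∀ j, s.arr 2 j = 0

theorem StoresTurns.step (hL : IsAdjacencyLists G L) (hlen : ∀ v, (L v).length ≤ 4)
    (T : IsSearchTree G r d pa co) (hl : IsLabelling pa C lab) (hr : C r = true)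
    (hB : IsBalancing G d lab co C (i + 1) good bad t)
    (h : StoresTurns L r d pa co C lab good bad t s) (hi : s.reg 10 = i + 1) {y : Fin n}
    (hy : d y = i + 1) :
    ∃ good' bad' t', IsBalancing G d lab co C i good' bad' t' ∧
      StoresTurns L r d pa co C lab good' bad' t' (balanceBody.sem s) ∧
      (balanceBody.sem s).reg 10 = i := by
  set B := block [.load 1 4 10, .load 11 3 1, .load 12 6 1, .load 13 9 1, .load 5 10 13,
    .load 6 11 13] with hB'
  have h4 : s.arr 4 (i + 1) = y := by rw [← hy]; exact h.order y (by omega)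
  have b1 : (B.sem s).reg 1 = y := by simp [hB', Instr.eval, hi, h4]
  have b5 : (B.sem s).reg 5 = good (lab y) := by simp [hB', Instr.eval, hi, h4, h.label, h.good]
  have b6 : (B.sem s).reg 6 = bad (lab y) := by simp [hB', Instr.eval, hi, h4, h.label, h.bad]
  have b11 : (B.sem s).reg 11 = d y := by simp [hB', Instr.eval, hi, h4, h.num]
  have b12 : (B.sem s).reg 12 = (co y).toNat := by simp [hB', Instr.eval, hi, h4, h.parity]
  have b13 : (B.sem s).reg 13 = lab y := by simp [hB', Instr.eval, hi, h4, h.label]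
  have bin : HasInput L (B.sem s) := h.input.congr rfl rfl (by simp [hB', Instr.eval])
  have b10 : (B.sem s).reg 10 = i + 1 := by simpa [hB', Instr.eval] using hi
  have ba : (B.sem s).arr = s.arr := rfl
  have hv : ∀ v w : Fin n, (v : ℕ) = w ↔ v = w := fun v w => Fin.ext_iff.symm
  have hbody : IsScanBody balanceTest (B.sem s)
      fun (z : Fin n) p => if d y < d z ∧ lab z ≠ lab y then
        if (co y ^^ co z ^^ t (lab z)) = true then (p.1 + 1, p.2) else (p.1, p.2 + 1) else p := by
    refine Prog.IsAuxiliary.isScanBody (by simp [balanceTest, Prog.IsAuxiliary, block,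
      Instr.IsAuxiliary]) fun s' z ha hk hz => ?_
    have k9 : s'.reg 9 = 0 := by rw [hk 9 (by simp [Kept]), bin.zero]
    have k11 : s'.reg 11 = d y := by rw [hk 11 (by simp [Kept]), b11]
    have k12 : s'.reg 12 = (co y).toNat := by rw [hk 12 (by simp [Kept]), b12]
    have k13 : s'.reg 13 = lab y := by rw [hk 13 (by simp [Kept]), b13]
    have hn : s'.arr 3 z = d z := by rw [ha, ba, h.num]
    have hc : s'.arr 6 z = (co z).toNat := by rw [ha, ba, h.parity]
    have hlz : s'.arr 9 z = lab z := by rw [ha, ba, h.label]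
    have ht : s'.arr 12 (lab z) = (t (lab z)).toNat := by rw [ha, ba, h.turn]
    by_cases h1 : d y < d z
    · by_cases h2 : lab z = lab y
      · simp [balanceTest, Instr.eval, hz, hn, hlz, k11, k13, h1, h2]
      · cases h3 : co z <;> cases h4 : co y <;> cases h5 : t (lab z) <;>
          simp [balanceTest, Instr.eval, hz, hn, hc, hlz, ht, k9, k11, k12, k13, h1, h2, h3, h4,
            h5, hv]
    · simp [balanceTest, Instr.eval, hz, hn, k11, h1]
  obtain ⟨e1, e2, e3⟩ := bin.scan b1 (hlen y) hbody
  rw [foldl_count hL, b5, b6] at e3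
  have hsucc := hB.succ T hl hr hy
  rw [balanceBody]
  simp only [sem_seq, ← hB']
  generalize (scan balanceTest).sem (B.sem s) = u at *
  have c1 : ∀ b, (Finset.univ.filter fun z => G.Adj y z ∧ (d y < d z ∧ lab z ≠ lab y) ∧
      (co y ^^ co z ^^ t (lab z)) = b) = turnNeighbors G d lab co t y b := fun b => by
    ext z; simp [turnNeighbors, and_assoc]
  rw [c1, c1] at e3
  obtain ⟨r5, r6⟩ := Prod.mk.inj e3
  have ea : u.arr = s.arr := e1.trans ba
  have r0 : u.reg 0 = n := by rw [e2 0 (by simp [Kept])]; exact bin.size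
  have r1 : u.reg 1 = y := by rw [e2 1 (by simp [Kept])]; exact b1
  have r8 : u.reg 8 = 1 := by rw [e2 8 (by simp [Kept])]; exact bin.one
  have r9 : u.reg 9 = 0 := by rw [e2 9 (by simp [Kept])]; exact bin.zero
  have r10 : u.reg 10 = i + 1 := by rw [e2 10 (by simp [Kept])]; exact b10
  have r13 : u.reg 13 = lab y := by rw [e2 13 (by simp [Kept])]; exact b13
  clear e2 e3 hbody c1
  simp only at hsucc
  simp only [Function.update_self] at hsucc
  generalize good (lab y) + (turnNeighbors G d lab co t y true).card = g at *
  generalize bad (lab y) + (turnNeighbors G d lab co t y false).card = b at *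
  refine ⟨_, _, _, hsucc, ?_⟩
  have key : ∀ s' : State, ∀ good' bad' t', (∀ a, a ≤ 9 → s'.arr a = s.arr a) →
      (∀ v : Fin n, s'.arr 10 v = good' v) → (∀ v : Fin n, s'.arr 11 v = bad' v) →
      (∀ v : Fin n, s'.arr 12 v = (t' v).toNat) →
      s'.reg 0 = n → s'.reg 8 = 1 → s'.reg 9 = 0 → s'.reg 10 = i →
      StoresTurns L r d pa co C lab good' bad' t' s' ∧ s'.reg 10 = i := by
    intro s' good' bad' t' ha h10 h11 h12 q0 q8 q9 q10
    refine ⟨⟨h.toStoresLabels.congr (fun a _ ha' => ha a ha')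
      ⟨q0.trans h.input.size.symm, q8.trans h.input.one.symm, q9.trans h.input.zero.symm⟩,
      h10, h11, h12, fun j => ?_⟩, q10⟩
    rw [ha 2 (by simp)]
    exact h.rest j
  have hc := h.cut y
  have hcc : C y = false ∨ C y = true := by cases C y <;> simp
  rcases hcc with hcc | hcc <;> by_cases hlt : g < b
  all_goals
    refine key _ _ _ _ ?_ ?_ ?_ ?_ ?_ ?_ ?_ ?_
    · intro a ha
      have : a ≠ 10 ∧ a ≠ 11 ∧ a ≠ 12 := by omega
      simp [Instr.eval, ea, r1, r5, r6, r8, r13, hc, hcc, hlt, this]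
    · intro v
      by_cases e : v = lab y <;>
        simp [Instr.eval, ea, r1, r5, r6, r8, r13, hc, hcc, hlt, hv, e, h.good]
    · intro v
      by_cases e : v = lab y <;>
        simp [Instr.eval, ea, r1, r5, r6, r8, r13, hc, hcc, hlt, hv, e, h.bad]
    · intro v
      by_cases e : v = y <;>
        simp [Instr.eval, ea, r1, r5, r6, r8, r13, hc, hcc, hlt, hv, e, h.turn]
    all_goals simp [Instr.eval, ea, r0, r1, r5, r6, r8, r9, r10, r13, hc, hcc, hlt]

theorem exec_balance (hL : IsAdjacencyLists G L) (hlen : ∀ v, (L v).length ≤ 4)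
    (T : IsSearchTree G r d pa co) (hl : IsLabelling pa C lab) (hr : C r = true)
    (hle : ∀ v, d v ≤ n) (hsurj : ∀ i, 0 < i → i ≤ n → ∃ v, d v = i)
    (h : StoresLabels L r d pa co C lab s) (hrest : ∀ a, a = 2 ∨ 10 ≤ a → ∀ j, s.arr a j = 0) :
    ∃ s' k good bad t, Exec balance s s' k ∧ k ≤ 2 + ((balanceBody.cost + 1) * n + 1) ∧
      IsBalancing G d lab co C 0 good bad t ∧ StoresTurns L r d pa co C lab good bad t s' := by
  obtain ⟨k₀, hk₀, hk₀'⟩ := (block_loopFree [.copy 10 0]).exec s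
  obtain ⟨s', k, he, hk, hend, m, hm, -, good, bad, t, hB, hS⟩ := exec_loop balanceBody_loopFree
    (b := .lt 9 10) (fun m s => s.reg 10 = m ∧ m ≤ n ∧ ∃ good bad t,
      IsBalancing G d lab co C m good bad t ∧ StoresTurns L r d pa co C lab good bad t s)
    (by
      rintro m s ⟨hm, hmn, good, bad, t, hB, hS⟩ hb
      have hb' : 0 < m := by rw [← hm, ← hS.input.zero]; exact hb
      obtain ⟨i, rfl⟩ : ∃ i, m = i + 1 := ⟨m - 1, by omega⟩
      obtain ⟨y, hy⟩ := hsurj _ hb' hmn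
      obtain ⟨good', bad', t', h1, h2, h3⟩ := hS.step hL hlen T hl hr hB hm hy
      exact ⟨i, by omega, h3, by omega, good', bad', t', h1, h2⟩)
    n ((block [.copy 10 0]).sem s)
    ⟨by simp [Instr.eval, h.input.size], le_rfl, fun _ => 0, fun _ => 0, fun _ => false,
      by
        have he : ∀ l b, turnDarts G d lab co (fun _ => false) n l b = ∅ := fun l b =>
          Finset.filter_eq_empty_iff.2 fun p _ hp => absurd hp.2.1 (not_lt.2 (hle _))
        exact ⟨by simp [he], by simp [he], fun l hl => absurd (hle l) (not_le.2 hl), by simp⟩,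
      h.congr (fun _ _ _ => rfl) (by simp [Instr.eval]), fun v => hrest 10 (by simp) _,
      fun v => hrest 11 (by simp) _, fun v => hrest 12 (by simp) _, fun j => hrest 2 (by simp) _⟩
  have h0 : m = 0 := by
    by_contra h0
    refine hend (?_ : s'.reg 9 < s'.reg 10)
    rw [hS.input.zero, hm]; omega
  subst h0
  refine ⟨s', k₀ + k, good, bad, t, .seq hk₀ he, ?_, hB, hS⟩
  simp only [block, Prog.cost] at hk₀'
  omega

end BalancePhase

/-! ### Writing the sides and improving the cut -/

namespace RAM

/-- Computes the side of a vertex from the parity of its depth and the turning of its piece. -/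
def sidesBody : Prog :=
  .seq (block [.load 20 6 10, .load 21 9 10, .load 22 12 21]) <|
  .seq (.ite (.ne 20 22) (block [.store 2 10 8]) .skip) (block [.inc 10])

def sides : Prog := .seq (block [.const 10 0]) (.loop (.lt 10 0) sidesBody)

theorem sidesBody_loopFree : sidesBody.LoopFree := by
  simp only [sidesBody, Prog.LoopFree, block_loopFree, and_true]

/-- Counts a neighbour on the other side in register `5`, one on the same side in register `6`. -/
def improveTest : Prog :=
  .seq (block [.load 20 2 4]) (.ite (.eq 20 11) (block [.inc 6]) (block [.inc 5]))

/-- Moves a vertex to the other side if this makes the cut larger. -/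
def improveBody : Prog :=
  .seq (block [.const 5 0, .const 6 0, .load 11 2 1]) <|
  .seq (scan improveTest) <|
  .seq (.ite (.lt 5 6) (.ite (.eq 11 8) (block [.store 2 1 9]) (block [.store 2 1 8])) .skip)
  (block [.inc 1])

/-- One pass of local improvement. -/
def improve : Prog := .seq (block [.const 1 0]) (.loop (.lt 1 0) improveBody)

theorem improveBody_loopFree : improveBody.LoopFree := by
  simp only [improveBody, improveTest, Prog.LoopFree, block_loopFree, and_true, true_and]
  exact scan_loopFree (by simp [Prog.LoopFree, block_loopFree])

/-- The approximation algorithm for the maximum cut. -/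
def largeCut : Prog :=
  .seq search <| .seq mark <| .seq label <| .seq balance <| .seq sides improve

end RAM

section SidesPhase

variable {n : ℕ} {L : Fin n → List (Fin n)} {r : Fin n} {i : ℕ} {d good bad : Fin n → ℕ}
  {pa lab : Fin n → Fin n} {co C t : Fin n → Bool} {s : State}

structure StoresSides (L : Fin n → List (Fin n)) (f : Fin n → Bool) (s : State) : Prop where
  input : HasInput L s
  side : ∀ v : Fin n, s.arr 2 v = (f v).toNat

theorem exec_sides (h : StoresTurns L r d pa co C lab good bad t s) :
    ∃ s' k, Exec sides s s' k ∧ k ≤ 2 + ((sidesBody.cost + 1) * n + 1) ∧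
      StoresSides L (fun v => co v ^^ t (lab v)) s' := by
  obtain ⟨k₀, hk₀, hk₀'⟩ := (block_loopFree [.const 10 0]).exec s
  obtain ⟨s', k, he, hk, hend, m, hm, hmn, hin, hside, -⟩ := exec_loop sidesBody_loopFree
    (b := .lt 10 0) (fun m s' => s'.reg 10 = n - m ∧ m ≤ n ∧ HasInput L s' ∧
      (∀ v : Fin n, s'.arr 2 v = if (v : ℕ) < n - m then (co v ^^ t (lab v)).toNat else 0) ∧
      ∀ a, a ≠ 2 → s'.arr a = s.arr a)
    (by
      rintro m s' ⟨hm, hmn, hin, hside, ha⟩ hb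
      have hb' : n - m < n := by rw [← hm]; exact hin.size ▸ hb
      obtain ⟨y, hy⟩ : ∃ y : Fin n, (y : ℕ) = n - m := ⟨⟨n - m, hb'⟩, rfl⟩
      have em : n - (m - 1) = y + 1 := by omega
      rw [← hy] at hm hside
      have g6 : s'.arr 6 y = (co y).toNat := by rw [ha 6 (by simp), h.parity]
      have g9 : s'.arr 9 y = lab y := by rw [ha 9 (by simp), h.label]
      have g12 : s'.arr 12 (lab y) = (t (lab y)).toNat := by rw [ha 12 (by simp), h.turn]
      have hone := hin.one
      have key : ∀ s'' : State, (∀ a, a ≠ 2 → s''.arr a = s'.arr a) →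
          (s''.arr 2 = Function.update (s'.arr 2) y (co y ^^ t (lab y)).toNat) →
          s''.reg 0 = s'.reg 0 ∧ s''.reg 8 = s'.reg 8 ∧ s''.reg 9 = s'.reg 9 →
          s''.reg 10 = y + 1 → s''.reg 10 = n - (m - 1) ∧ m - 1 ≤ n ∧ HasInput L s'' ∧
            (∀ v : Fin n, s''.arr 2 v =
              if (v : ℕ) < n - (m - 1) then (co v ^^ t (lab v)).toNat else 0) ∧
            ∀ a, a ≠ 2 → s''.arr a = s.arr a := by
        intro s'' q1 q2 q3 q4
        refine ⟨by omega, by omega, hin.congr (q1 0 (by simp)) (q1 1 (by simp)) q3, fun v => ?_,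
          fun a ha' => (q1 a ha').trans (ha a ha')⟩
        rw [q2, em]
        by_cases e : v = y
        · subst e; simp
        · have e' : (v : ℕ) ≠ y := fun e' => e (Fin.ext e')
          have : (v : ℕ) < y + 1 ↔ (v : ℕ) < y := by omega
          rw [Function.update_of_ne e', hside]
          simp only [this]
      -- Side `0` is never written; array `2` still holds zeros at the vertices not yet treated.
      have h0 : s'.arr 2 y = 0 := by rw [hside, if_neg (lt_irrefl _)]
      have h0' : Function.update (s'.arr 2) y 0 = s'.arr 2 := by
        rw [← h0, Function.update_eq_self]
      refine ⟨m - 1, by omega, ?_⟩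
      cases h1 : co y <;> cases h2 : t (lab y) <;>
      · rw [h1] at g6
        rw [h2] at g12
        refine key _ ?_ ?_ ?_ ?_
        · intro a ha'; simp [sidesBody, Instr.eval, hm, g6, g9, g12, ha']
        all_goals simp [sidesBody, Instr.eval, hm, g6, g9, g12, hone, h0', h1, h2])
    n ((block [.const 10 0]).sem s)
    ⟨by simp [Instr.eval], le_rfl, h.input.congr rfl rfl (by simp [Instr.eval]),
      fun v => by simpa [Instr.eval] using h.rest v, fun a _ => rfl⟩
  have h0 : m = 0 := by
    by_contra h0
    refine hend (?_ : s'.reg 10 < s'.reg 0)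
    rw [hin.size, hm]; omega
  subst h0
  refine ⟨s', k₀ + k, .seq hk₀ he, ?_, hin, fun v => by simpa using hside v⟩
  simp only [block, Prog.cost] at hk₀'
  omega

end SidesPhase

section ImprovePhase

variable {n : ℕ} {G : SimpleGraph (Fin n)} [DecidableRel G.Adj] {L : Fin n → List (Fin n)}
  {f : Fin n → Bool} {s : State}

theorem StoresSides.step (hL : IsAdjacencyLists G L) (hlen : ∀ v, (L v).length ≤ 4)
    (h : StoresSides L f s) {y : Fin n} (hy : s.reg 1 = y) :
    StoresSides L (if crossDeg G f y < innerDeg G f y then Function.update f y (!f y) else f)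
      (improveBody.sem s) ∧ (improveBody.sem s).reg 1 = y + 1 := by
  set B := block [.const 5 0, .const 6 0, .load 11 2 1] with hB
  have b1 : (B.sem s).reg 1 = y := by simp [hB, Instr.eval, hy]
  have b5 : (B.sem s).reg 5 = 0 := by simp [hB, Instr.eval]
  have b6 : (B.sem s).reg 6 = 0 := by simp [hB, Instr.eval]
  have b11 : (B.sem s).reg 11 = (f y).toNat := by simp [hB, Instr.eval, hy, h.side]
  have bin : HasInput L (B.sem s) := h.input.congr rfl rfl (by simp [hB, Instr.eval])
  have ba : (B.sem s).arr = s.arr := rfl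
  have hbody : IsScanBody improveTest (B.sem s)
      -- The trivial condition brings the fold into the form of `foldl_count`.
      fun (z : Fin n) p => if True then if (f y ^^ f z) = true then (p.1 + 1, p.2)
        else (p.1, p.2 + 1) else p := by
    refine Prog.IsAuxiliary.isScanBody (by simp [improveTest, Prog.IsAuxiliary, block,
      Instr.IsAuxiliary]) fun s' z ha hk hz => ?_
    have k11 : s'.reg 11 = (f y).toNat := by rw [hk 11 (by simp [Kept]), b11]
    have hn : s'.arr 2 z = (f z).toNat := by rw [ha, ba, h.side]
    cases h1 : f z <;> cases h2 : f y <;> simp [improveTest, Instr.eval, hz, hn, k11, h1, h2]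
  obtain ⟨e1, e2, e3⟩ := bin.scan b1 (hlen y) hbody
  rw [foldl_count hL y (fun _ => True), b5, b6] at e3
  rw [improveBody]
  simp only [sem_seq, ← hB]
  generalize (scan improveTest).sem (B.sem s) = u at *
  have c1 : (Finset.univ.filter fun z => G.Adj y z ∧ True ∧ (f y ^^ f z) = true).card =
      crossDeg G f y := by
    rw [crossDeg]; congr 1; ext z; cases f y <;> cases f z <;> simp
  have c2 : (Finset.univ.filter fun z => G.Adj y z ∧ True ∧ (f y ^^ f z) = false).card =
      innerDeg G f y := by
    rw [innerDeg]; congr 1; ext z; cases f y <;> cases f z <;> simp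
  rw [c1, c2, zero_add, zero_add] at e3
  obtain ⟨r5, r6⟩ := Prod.mk.inj e3
  have ea : u.arr = s.arr := e1.trans ba
  have r0 : u.reg 0 = n := by rw [e2 0 (by simp [Kept])]; exact bin.size
  have r1 : u.reg 1 = y := by rw [e2 1 (by simp [Kept])]; exact b1
  have r8 : u.reg 8 = 1 := by rw [e2 8 (by simp [Kept])]; exact bin.one
  have r9 : u.reg 9 = 0 := by rw [e2 9 (by simp [Kept])]; exact bin.zero
  have r11 : u.reg 11 = (f y).toNat := by rw [e2 11 (by simp [Kept])]; exact b11
  have hv : ∀ v w : Fin n, (v : ℕ) = w ↔ v = w := fun v w => Fin.ext_iff.symm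
  by_cases hlt : crossDeg G f y < innerDeg G f y
  · rw [if_pos hlt]
    cases hf : f y <;>
    · rw [hf] at r11
      refine ⟨⟨h.input.congr ?_ ?_ ?_, fun v => ?_⟩, ?_⟩
      any_goals simp [Instr.eval, ea, r0, r1, r5, r6, r8, r9, r11, hlt, h.input.size,
        h.input.one, h.input.zero]
      by_cases e : v = y <;> simp [hv, e, h.side]
  · rw [if_neg hlt]
    refine ⟨⟨h.input.congr ?_ ?_ ?_, fun v => ?_⟩, ?_⟩
    all_goals simp [Instr.eval, ea, r0, r1, r5, r6, r8, r9, hlt, h.input.size,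
        h.input.one, h.input.zero, h.side]

/-- One pass suffices. Each move gains at least one edge, by `crossing_update`; if none is made,
every vertex was tested against the initial cut, which is therefore locally optimal. -/
theorem exec_improve (hL : IsAdjacencyLists G L) (hlen : ∀ v, (L v).length ≤ 4) {d : Fin n → ℕ}
    (hd : Function.Injective d) (h : StoresSides L f s) :
    ∃ s' k f', Exec improve s s' k ∧ k ≤ 2 + ((improveBody.cost + 1) * n + 1) ∧
      StoresSides L f' s' ∧ (crossing G d f + 1 ≤ crossing G d f' ∨
        f' = f ∧ ∀ v, innerDeg G f v ≤ crossDeg G f v) := by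
  obtain ⟨k₀, hk₀, hk₀'⟩ := (block_loopFree [.const 1 0]).exec s
  obtain ⟨s', k, he, hk, hend, m, hm, hmn, f', hS, hf⟩ := exec_loop improveBody_loopFree
    (b := .lt 1 0) (fun m s => s.reg 1 = n - m ∧ m ≤ n ∧ ∃ f', StoresSides L f' s ∧
      (crossing G d f + 1 ≤ crossing G d f' ∨
        f' = f ∧ ∀ v : Fin n, (v : ℕ) < n - m → innerDeg G f v ≤ crossDeg G f v))
    (by
      rintro m s ⟨hm, hmn, f', hS, hf⟩ hb
      have hb' : n - m < n := by rw [← hm]; exact hS.input.size ▸ hb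
      obtain ⟨y, hy⟩ : ∃ y : Fin n, (y : ℕ) = n - m := ⟨⟨n - m, hb'⟩, rfl⟩
      have em : n - (m - 1) = y + 1 := by omega
      obtain ⟨h1, h2⟩ := hS.step hL hlen (hm.trans hy.symm)
      refine ⟨m - 1, by omega, by omega, by omega, _, h1, ?_⟩
      have hupd := crossing_update (G := G) hd f' y
      split_ifs with hlt
      · left
        rcases hf with hf | ⟨rfl, -⟩ <;> omega
      · refine hf.imp_right fun ⟨e, hf⟩ => ⟨e, fun v hv => ?_⟩
        by_cases e' : v = y
        · subst e e'; exact not_lt.1 hlt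
        · have : (v : ℕ) ≠ y := fun e => e' (Fin.ext e)
          exact hf v (by omega))
    n ((block [.const 1 0]).sem s)
    ⟨by simp [Instr.eval], le_rfl, f, ⟨h.input.congr rfl rfl (by simp [Instr.eval]), h.side⟩,
      Or.inr ⟨rfl, fun v hv => by omega⟩⟩
  have h0 : m = 0 := by
    by_contra h0
    refine hend (?_ : s'.reg 1 < s'.reg 0)
    rw [hS.input.size, hm]; omega
  subst h0
  refine ⟨s', k₀ + k, f', .seq hk₀ he, ?_, hS, hf.imp_right fun ⟨e, hf⟩ => ⟨e, fun v => hf v v.2⟩⟩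
  simp only [block, Prog.cost] at hk₀'
  omega

end ImprovePhase

/-! ### The assembled algorithm -/

theorem corollary2 :
    ∃ (p : RAM.Prog) (C : ℕ),
      ∀ (n : ℕ) (G : SimpleGraph (Fin n)) [DecidableRel G.Adj] (L : Fin n → List (Fin n)),
        G.Connected → G.maxDegree ≤ 4 → IsAdjacencyLists G L →
        ∃ (s : RAM.State) (t : ℕ),
          RAM.Exec p (inputState L) s t ∧ t ≤ C * n ∧
          (3 / 4 : ℚ) * (maxCut G : ℚ) ≤ (cutSize G (outputSide n s) : ℚ) := by
  -- The fixed overheads are `7` steps for the search and `3` for each of the other five phases.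
  -- Their sum `22` is at most `22 * n`, as a connected graph has a vertex. The search may take `2n`
  -- rounds, the other phases `n` each.
  refine ⟨largeCut, 22 + 2 * (searchBody.cost + 1) + (markBody.cost + 1) + (labelBody.cost + 1) +
    (balanceBody.cost + 1) + (sidesBody.cost + 1) + (improveBody.cost + 1), ?_⟩
  intro n G _ L hG hdeg hL
  have hdeg' : ∀ v, G.degree v ≤ 4 := fun v => (G.degree_le_maxDegree v).trans hdeg
  have hlen : ∀ v, (L v).length ≤ 4 := by
    intro v
    rw [← List.toFinset_card_of_nodup (hL v).1]
    convert hdeg' v using 1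
    rw [← G.card_neighborFinset_eq_degree]
    congr 1
    ext w
    simp [(hL v).2]
  have hn : 0 < n := by
    obtain ⟨v⟩ := hG.nonempty
    exact v.pos
  obtain ⟨s₁, t₁, d, pa, co, x₁, ht₁, T, hS₁, hle, hsurj, hrest₁⟩ :=
    exec_search (r := ⟨0, hn⟩) hL hlen rfl hG.preconnected
  obtain ⟨s₂, t₂, H, C, x₂, ht₂, hC, hS₂⟩ := exec_mark hL hlen T hle hsurj hS₁ hrest₁
  have hr := T.cut_root hC
  obtain ⟨s₃, t₃, lab, x₃, ht₃, hl, hS₃, hrest₃⟩ := exec_label T hr rfl hle hsurj hS₂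
  obtain ⟨s₄, t₄, good, bad, t, x₄, ht₄, hB, hS₄⟩ :=
    exec_balance hL hlen T hl hr hle hsurj hS₃ hrest₃
  obtain ⟨s₅, t₅, x₅, ht₅, hS₅⟩ := exec_sides hS₄
  obtain ⟨s₆, t₆, f, x₆, ht₆, hS₆, himp⟩ := exec_improve hL hlen T.inj hS₅
  refine ⟨s₆, _, .seq x₁ <| .seq x₂ <| .seq x₃ <| .seq x₄ <| .seq x₅ x₆, ?_, ?_⟩
  · simp only [add_mul, one_mul] at *
    have : (2 * searchBody.cost + 2 * 1) * n = 2 * (searchBody.cost * n) + 2 * n := by ring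
    have : searchBody.cost * (2 * n) = 2 * (searchBody.cost * n) := by ring
    have : (2 * (searchBody.cost + 1)) * n = 2 * (searchBody.cost * n) + 2 * n := by ring
    omega
  · have hout : (fun v => decide (v ∈ outputSide n s₆)) = f := by
      funext v
      cases h : f v <;> simp [outputSide, hS₆.side, h]
    have hmax : 3 * maxCut G ≤ 4 * cutSize G (outputSide n s₆) := by
      obtain ⟨B, -, hB'⟩ := Finset.exists_mem_eq_sup (Finset.univ : Finset (Finset (Fin n)))
        Finset.univ_nonempty (cutSize G)
      rw [maxCut, hB', cutSize_eq_crossing T.inj, cutSize_eq_crossing T.inj, hout]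
      -- On each piece the balanced colouring is the parity of the depth, possibly with the sides
      -- exchanged.
      refine (T.decomposition hC hl).three_mul_crossing_le hdeg' (fun v w h => ?_)
        (hB.card_le T hl hr) himp _
      simp only [h]
      cases co v <;> cases co w <;> cases t (lab w) <;> simp
    have : (3 * maxCut G : ℚ) ≤ 4 * cutSize G (outputSide n s₆) := by exact_mod_cast hmax
    linarith
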